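/- Theorem (a generalization of Hilbert's theorem 94). Let $K/F$ be a finite cyclic extension of number fields with Galois group $G$, and let $S$ be a finite set of primes of $F$ containing the set $S_\infty$ of all archimedean primes of $F$; write $S$ also for the set of primes of $K$ lying above the primes in $S$. Let $U_{F,S}$ and $U_{K,S}$ be the groups of $S$-units of $F$ and $K$ (elements of $F^\times$, $K^\times$ that are units at every non-archimedean prime outside $S$), let $\mathrm{Cl}(F)_S$ and $\mathrm{Cl}(K)_S$ be the $S$-ideal class groups (the ideal class group modulo the subgroup generated by the classes of the non-archimedean primes in $S$; equivalently, the class group of the ring of $S$-integers), and let $\epsilon_{K/F,S}:\mathrm{Cl}(F)_S\to \mathrm{Cl}(K)_S$ be the $S$-capitulation map, induced by extension of ideals from $F$ to $K$. For each $v\in S$ choose a prime $w$ of $K$ above $v$, and let $G_w\subseteq G$ be the decomposition group of $w$. If $K/F$ is unramified at every prime outside $S$, then $$\Big(\prod_{v\in S}|G_w|\Big)\cdot|\mathrm{Ker}(\epsilon_{K/F,S})| = \big(U_{F,S}:N_{K/F}(U_{K,S})\big)\cdot[K:F].$$ -/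

import Mathlib

open NumberField IsDedekindDomain
open scoped Pointwise nonZeroDivisors

noncomputable section

namespace SHilbert

/-- The primes (places) of a number field `F`: the nonzero prime ideals of the ring of integers
(the non-archimedean ones) together with the infinite places (the archimedean ones). -/
abbrev Place (F : Type*) [Field F] : Type _ :=
  HeightOneSpectrum (𝓞 F) ⊕ InfinitePlace F

/-- The non-archimedean primes belonging to a set `S` of primes of `F`. -/
def finitePart {F : Type*} [Field F] (S : Set (Place F)) : Set (HeightOneSpectrum (𝓞 F)) :=
  {p | Sum.inl p ∈ S}

/-- The prime `w` of `K` lies above the prime `v` of `F`. -/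
def LiesAbove {F K : Type*} [Field F] [Field K] [Algebra F K] : Place K → Place F → Prop
  | Sum.inl P, Sum.inl p => P.asIdeal.LiesOver p.asIdeal
  | Sum.inr w, Sum.inr v => w.comap (algebraMap F K) = v
  | _, _ => False

/-- The set of primes of `K` lying above the primes in `S`. -/
def above {F : Type*} (K : Type*) [Field F] [Field K] [Algebra F K] (S : Set (Place F)) :
    Set (Place K) :=
  {w | ∃ v ∈ S, LiesAbove w v}

/-- The decomposition group of a prime `w` of `K`: the stabilizer of `w` in `Gal(K/F)`. -/
def decompositionGroup (F : Type*) {K : Type*} [Field F] [Field K] [Algebra F K] :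
    Place K → Subgroup Gal(K/F)
  | Sum.inl P => MulAction.stabilizer Gal(K/F) P.asIdeal
  | Sum.inr w => MulAction.stabilizer Gal(K/F) w

/-- The prime `w` of `K` is unramified in `K/F`. -/
def IsUnramified (F : Type*) {K : Type*} [Field F] [Field K] [Algebra F K] : Place K → Prop
  | Sum.inl P => Algebra.IsUnramifiedAt (𝓞 F) P.asIdeal
  | Sum.inr w => w.IsUnramified F

/-- `K/F` is unramified outside the set `S` of primes of `F`. -/
def UnramifiedOutside {F : Type*} (K : Type*) [Field F] [Field K] [Algebra F K]
    (S : Set (Place F)) : Prop :=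
  ∀ w : Place K, w ∉ above K S → IsUnramified F w

/-- The group `U_{F,S}` of `S`-units of `F`. -/
abbrev SUnits (F : Type*) [Field F] [NumberField F] (S : Set (Place F)) : Subgroup Fˣ :=
  (finitePart S).unit F

/-- The subgroup of the ideal class group generated by the classes of the primes in `S`. -/
def primeClasses (F : Type*) [Field F] [NumberField F] (S : Set (Place F)) :
    Subgroup (ClassGroup (𝓞 F)) :=
  Subgroup.closure {c | ∃ p ∈ finitePart S,
    c = ClassGroup.mk0 ⟨p.asIdeal, mem_nonZeroDivisors_of_ne_zero p.ne_bot⟩}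

/-- The `S`-ideal class group `Cl(F)_S`: the ideal class group modulo the classes of the primes
in `S`. (Equivalently: fractional ideals prime to `S` modulo the prime-to-`S` parts of the
principal ones, or the class group of the ring of `S`-integers.) -/
abbrev SClassGroup (F : Type*) [Field F] [NumberField F] (S : Set (Place F)) : Type _ :=
  ClassGroup (𝓞 F) ⧸ primeClasses F S

section maps

variable (F K : Type*) [Field F] [NumberField F] [Field K] [NumberField K] [Algebra F K]
  (S : Set (Place F))

theorem primeClasses_le_comap :
    primeClasses F S ≤ (primeClasses K (above K S)).comap (ClassGroup.extendedHom (𝓞 F) (𝓞 K)) := by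
  rw [primeClasses, Subgroup.closure_le]
  rintro _ ⟨p, hp, rfl⟩
  have hmax : p.asIdeal.IsMaximal := p.isMaximal
  rw [SetLike.mem_coe, Subgroup.mem_comap, ClassGroup.extendedHom_mk0]
  have key : ∀ (s : Finset (Ideal (𝓞 K))) (e : Ideal (𝓞 K) → ℕ),
      (∀ P ∈ s, P ∈ p.asIdeal.primesOver (𝓞 K)) → ∀ J : (Ideal (𝓞 K))⁰,
      (J : Ideal (𝓞 K)) = ∏ P ∈ s, P ^ e P →
      ClassGroup.mk0 J ∈ primeClasses K (above K S) := by
    classical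
    intro s e
    induction s using Finset.induction_on with
    | empty =>
      intro _ J hJ
      have : J = 1 := Subtype.ext (by simpa using hJ)
      rw [this, map_one]
      exact one_mem _
    | insert P s hPs ih =>
      intro h J hJ
      have hP := h P (Finset.mem_insert_self _ _)
      have hPp : P.IsPrime := hP.1
      have hPl : P.LiesOver p.asIdeal := hP.2
      have hP0 : P ≠ ⊥ := Ideal.ne_bot_of_liesOver_of_ne_bot p.ne_bot P
      rw [Finset.prod_insert hPs] at hJ
      have hJ0 : (J : Ideal (𝓞 K)) ≠ 0 := nonZeroDivisors.coe_ne_zero J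
      have hr : (∏ Q ∈ s, Q ^ e Q) ≠ 0 := fun h0 => hJ0 (by rw [hJ, h0, mul_zero])
      have hJ' : J = (⟨P, mem_nonZeroDivisors_of_ne_zero hP0⟩ : (Ideal (𝓞 K))⁰) ^ e P *
          ⟨_, mem_nonZeroDivisors_of_ne_zero hr⟩ := Subtype.ext hJ
      rw [hJ', map_mul, map_pow]
      refine mul_mem (pow_mem (Subgroup.subset_closure ?_) _)
        (ih (fun Q hQ => h Q (Finset.mem_insert_of_mem hQ)) _ rfl)
      exact ⟨⟨P, hPp, hP0⟩, ⟨Sum.inl p, hp, hPl⟩, rfl⟩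
  classical
  have hprod := Ideal.map_algebraMap_eq_finsetProd_pow (R := 𝓞 K) p.ne_bot
  refine key _ (fun P => P.ramificationIdx (𝓞 F)) (fun P hP => ?_) _ hprod
  simpa using hP

/-- The `S`-capitulation map `ε_{K/F,S} : Cl(F)_S → Cl(K)_S`, induced by extension of ideals. -/
def capitulationMap : SClassGroup F S →* SClassGroup K (above K S) :=
  QuotientGroup.map _ _ (ClassGroup.extendedHom (𝓞 F) (𝓞 K)) (primeClasses_le_comap F K S)

end maps

section norm

variable {F K : Type*} [Field F] [NumberField F] [Field K] [NumberField K] [Algebra F K]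

/-- The action of `Gal(K/F)` on the nonzero primes of `K`. -/
def smulPrime (σ : Gal(K/F)) (P : HeightOneSpectrum (𝓞 K)) : HeightOneSpectrum (𝓞 K) where
  asIdeal := σ • P.asIdeal
  isPrime := inferInstance
  ne_bot := fun h => P.ne_bot (by rw [← inv_smul_smul σ P.asIdeal, h]; exact Ideal.map_bot)

set_option linter.unusedSectionVars false in
theorem intValuation_smul (σ : Gal(K/F)) (P : HeightOneSpectrum (𝓞 K)) (a : 𝓞 K) :
    (smulPrime σ P).intValuation (σ • a) = P.intValuation a := by
  rcases eq_or_ne a 0 with rfl | ha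
  · simp
  rw [HeightOneSpectrum.intValuation_eq_exp_neg_multiplicity _ (by rwa [Ne, smul_eq_zero_iff_eq]),
    HeightOneSpectrum.intValuation_eq_exp_neg_multiplicity _ ha]
  have h1 : Ideal.span {σ • a} = σ • Ideal.span {a} := by
    rw [Ideal.pointwise_smul_def, Ideal.map_span, Set.image_singleton]; rfl
  have : multiplicity (σ • P.asIdeal) (σ • Ideal.span {a}) =
      multiplicity P.asIdeal (Ideal.span {a}) := by
    refine multiplicity_map_eq (MulDistribMulAction.toMulEquiv (Ideal (𝓞 K)) σ)
  simp [smulPrime, h1, this]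

theorem valuation_smul (σ : Gal(K/F)) (P : HeightOneSpectrum (𝓞 K)) (x : K) :
    (smulPrime σ P).valuation K (σ x) = P.valuation K x := by
  obtain ⟨a, b, hb, rfl⟩ := IsFractionRing.div_surjective (A := 𝓞 K) x
  have h : ∀ c : 𝓞 K, σ (algebraMap (𝓞 K) K c) = algebraMap (𝓞 K) K (σ • c) := fun c => rfl
  simp [h, HeightOneSpectrum.valuation_of_algebraMap, intValuation_smul]

theorem norm_mem_SUnits [IsGalois F K] (S : Set (Place F)) (x : Kˣ)
    (hx : x ∈ SUnits K (above K S)) : Units.map (Algebra.norm F) x ∈ SUnits F S := by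
  intro v hv
  obtain ⟨P, hP, hPv⟩ := v.asIdeal.exists_ideal_over_prime_of_isIntegral_of_isDomain
    (S := 𝓞 K) (by simp)
  let w : HeightOneSpectrum (𝓞 K) :=
    ⟨P, hP, fun h => v.ne_bot (by rw [← hPv, h, Ideal.comap_bot_of_injective _
      (FaithfulSMul.algebraMap_injective _ _)])⟩
  have hw : w.asIdeal.LiesOver v.asIdeal := ⟨hPv.symm⟩
  have hval : ∀ σ : Gal(K/F), w.valuation K (σ (x : K)) = 1 := by
    intro σ
    have h := valuation_smul σ (smulPrime σ⁻¹ w) (x : K)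
    have h2 : smulPrime σ (smulPrime σ⁻¹ w) = w :=
      HeightOneSpectrum.ext (smul_inv_smul σ w.asIdeal)
    rw [h2] at h
    rw [h]
    refine hx _ ?_
    rintro ⟨v' | v', hv', hl⟩
    · refine hv ?_
      have hl' : (σ⁻¹ • w.asIdeal).LiesOver v'.asIdeal := hl
      have h3 : v'.asIdeal = v.asIdeal := by
        rw [hl'.over, hw.over, Ideal.under_smul]
      rw [← HeightOneSpectrum.ext h3]
      exact hv'
    · exact hl
  have hval' : w.valuation K (algebraMap F K (Algebra.norm F (x : K))) = 1 := by
    rw [Algebra.norm_eq_prod_automorphisms, map_prod]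
    exact Finset.prod_eq_one fun σ _ => hval σ
  rw [← HeightOneSpectrum.valuation_liesOver K v w] at hval'
  exact (pow_eq_one_iff.1 hval').resolve_right
    (Ideal.IsDedekindDomain.ramificationIdx'_ne_zero_of_liesOver w.asIdeal v.ne_bot)

/-- The norm map `N_{K/F} : U_{K,S} → U_{F,S}`. -/
def normSUnits [IsGalois F K] (S : Set (Place F)) : SUnits K (above K S) →* SUnits F S where
  toFun x := ⟨Units.map (Algebra.norm F) x.1, norm_mem_SUnits S x.1 x.2⟩
  map_one' := Subtype.ext (map_one _)
  map_mul' _ _ := Subtype.ext (map_mul _ _ _)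

end norm

end SHilbert

end

/-!
Let `G = Gal(K/F)` be generated by `σ`, and let `U` be the group of `S`-units of `K`, written
additively. With `T = σ - 1` and the norm `N = ∑ g`, the two Tate cohomology groups of a `G`-module
`M` are `ker T / im N` and `ker N / im T`; their orders are used here as relative indices of
subgroups of `M`. The theorem follows from three facts.

* `relIndex_sUnitsNorm_range`: since `U ^ G` is the group of `S`-units of `F`, the index of the
  degree zero group of `U` is the index of the norms of `S`-units.

* `relIndex_sUnitsDiff_range`: the order of the degree one group of `U` is the order of the
  capitulation kernel. Consider pairs `(x, D)` of `x` in `Kˣ` and a divisor `D` of `F` which have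
  the same orders outside `S`. By Hilbert's theorem 90 and because `K/F` is unramified outside `S`,
  the elements `σ x / x` are exactly the `S`-units of norm one. The classes of the `D` are exactly
  the capitulating ones. Finally `σ x / x` lies in `T U` if and only if `x` is the product of an
  element of `Fˣ` and an `S`-unit, that is, if and only if `D` is principal outside `S`.

* `prod_card_stabilizer_mul_relIndex`: the Herbrand quotient of `U` is the product of the orders of
  the decomposition groups divided by the order of `G`. The Herbrand quotient does not change when
  a module is replaced by a submodule of finite index (`relIndex_range_ker_comparison`), and
  `U × ℤ` contains the permutation module on the places of `K` above `S` with finite index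
  (`exists_permutation_sublattice`). For the latter, the basis vector of a finite place is sent to
  an `S`-unit generating a power of that prime, and that of an infinite place `w` to `(u, 1)` for a
  unit `u` of absolute value less than one at all infinite places other than `w`. Injectivity comes
  from the product formula and a sign argument (`eq_zero_of_sum_mul_eq_zero`), finiteness of the
  index from Dirichlet's unit theorem. For a permutation module the degree one group vanishes and
  the degree zero group has order the product of the orders of the stabilizers.
-/

noncomputable section

namespace SHilbert

/-! ### Tate cohomology indices of a cyclic group action -/

/-- The index of a subgroup is the product of the index of its image under a homomorphism and the
index of its intersection with the kernel. -/
theorem _root_.AddSubgroup.index_eq_relIndex_map_mul {B C : Type*} [AddCommGroup B] [AddCommGroup C]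
    (D : AddSubgroup B) (f : B →+ C) :
    D.index = (D.map f).relIndex f.range * D.relIndex f.ker := by
  rw [← AddSubgroup.index_comap, AddSubgroup.comap_map_eq, ← AddSubgroup.relIndex_sup_left f.ker D,
    mul_comm, AddSubgroup.relIndex_mul_index le_sup_left]

/-- Invariance of the Herbrand quotient: an equivariant injection with image of finite index
preserves the ratio of the indices `(ker T : im N)` and `(ker N : im T)`. The statement is
cross-multiplied, so that none of these indices has to be finite. -/
theorem relIndex_range_ker_comparison {A B : Type*} [AddCommGroup A] [AddCommGroup B]
    (φ : A →+ B) (hφ : Function.Injective φ) (hfin : φ.range.index ≠ 0)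
    (T N : A →+ A) (T' N' : B →+ B) (hT : ∀ a, φ (T a) = T' (φ a)) (hN : ∀ a, φ (N a) = N' (φ a))
    (hTN : ∀ b, T' (N' b) = 0) (hNT : ∀ b, N' (T' b) = 0) :
    N.range.relIndex T.ker * T'.range.relIndex N'.ker =
      N'.range.relIndex T'.ker * T.range.relIndex N.ker := by
  -- Inside `B`, both sides are the index of `g' (φ A)` in `ker f'`, computed through the subgroups
  -- `φ A ∩ ker f'` and `im g'`. This is used for `(f, g) = (T, N)` and for `(f, g) = (N, T)`.
  have key : ∀ (f g : A →+ A) (f' g' : B →+ B), (∀ a, φ (f a) = f' (φ a)) →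
      (∀ a, φ (g a) = g' (φ a)) → (∀ b, f' (g' b) = 0) →
      g.range.relIndex f.ker * φ.range.relIndex f'.ker =
        (φ.range.map g').relIndex g'.range * g'.range.relIndex f'.ker := by
    intro f g f' g' hf hg hfg
    have hker : f.ker.map φ = φ.range ⊓ f'.ker := by
      ext b
      simp only [AddSubgroup.mem_map, AddSubgroup.mem_inf, AddMonoidHom.mem_range,
        AddMonoidHom.mem_ker]
      constructor
      · rintro ⟨a, ha, rfl⟩
        exact ⟨⟨a, rfl⟩, by rw [← hf, ha, map_zero]⟩
      · rintro ⟨⟨a, rfl⟩, ha⟩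
        exact ⟨a, hφ (by rw [hf, ha, map_zero]), rfl⟩
    have hrange : g.range.map φ = φ.range.map g' := by
      rw [AddMonoidHom.map_range, AddMonoidHom.map_range]
      congr 1
      ext a
      exact hg a
    have hle : g'.range ≤ f'.ker := by
      rintro _ ⟨b, rfl⟩
      exact hfg b
    have hle' : φ.range.map g' ≤ g'.range := by
      rintro _ ⟨b, -, rfl⟩
      exact ⟨b, rfl⟩
    rw [← AddSubgroup.relIndex_map_map_of_injective _ _ hφ, hker, hrange,
      ← AddSubgroup.inf_relIndex_right φ.range, AddSubgroup.relIndex_mul_relIndex _ _ _ _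
        inf_le_right, AddSubgroup.relIndex_mul_relIndex _ _ _ hle' hle]
    rw [← hker, ← hrange]
    refine AddSubgroup.map_mono ?_
    rintro _ ⟨a, rfl⟩
    exact hφ (by rw [hf, hg, hfg, map_zero])
  have h0 := key T N T' N' hT hN hTN
  have h1 := key N T N' T' hN hT hNT
  have hT := φ.range.index_eq_relIndex_map_mul T'
  have hN := φ.range.index_eq_relIndex_map_mul N'
  have e : φ.range.index * (N.range.relIndex T.ker * T'.range.relIndex N'.ker) =
      φ.range.index * (N'.range.relIndex T'.ker * T.range.relIndex N.ker) := by
    calc _ = (N.range.relIndex T.ker * φ.range.relIndex T'.ker) *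
          ((φ.range.map T').relIndex T'.range * T'.range.relIndex N'.ker) := by rw [hT]; ring
      _ = ((φ.range.map N').relIndex N'.range * N'.range.relIndex T'.ker) *
          (T.range.relIndex N.ker * φ.range.relIndex N'.ker) := by rw [h0, h1]
      _ = _ := by rw [hN]; ring
  exact Nat.eq_of_mul_eq_mul_left (Nat.pos_of_ne_zero hfin) e

theorem _root_.AddSubgroup.relIndex_prod {A B : Type*} [AddCommGroup A] [AddCommGroup B]
    (H H' : AddSubgroup A) (K K' : AddSubgroup B) :
    (H.prod K).relIndex (H'.prod K') = H.relIndex H' * K.relIndex K' := by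
  rw [AddSubgroup.relIndex, AddSubgroup.relIndex, AddSubgroup.relIndex, ← AddSubgroup.index_prod,
    ← AddSubgroup.index_comap_of_surjective _
      (f := (AddSubgroup.prodEquiv H' K').toAddMonoidHom) (AddSubgroup.prodEquiv H' K').surjective]
  rfl

/-! ### Permutation modules -/

section Permutation

/-- The operator `σ - 1` on the permutation module `X → ℤ`, where `σ` sends the basis vector at
`x` to the one at `σ • x`. -/
def permDiff {G : Type*} (X : Type*) [Group G] [MulAction G X] (σ : G) : (X → ℤ) →+ (X → ℤ) where
  toFun f x := f (σ⁻¹ • x) - f x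
  map_zero' := by ext; simp
  map_add' f g := by ext; simp; ring

/-- The norm `∑ g` on the permutation module `X → ℤ`. -/
def permNorm (G X : Type*) [Group G] [Fintype G] [MulAction G X] : (X → ℤ) →+ (X → ℤ) where
  toFun f x := ∑ g : G, f (g • x)
  map_zero' := by ext; simp
  map_add' f g := by ext; simp [Finset.sum_add_distrib]

variable {G X : Type*} [Group G] [MulAction G X]

theorem permDiff_apply (σ : G) (f : X → ℤ) (x : X) : permDiff X σ f x = f (σ⁻¹ • x) - f x := rfl

theorem permNorm_apply [Fintype G] (f : X → ℤ) (x : X) :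
    permNorm G X f x = ∑ g : G, f (g • x) := rfl

theorem permDiff_eq_zero_iff {σ : G} (hσ : ∀ g, g ∈ Subgroup.zpowers σ) (f : X → ℤ) :
    permDiff X σ f = 0 ↔ ∀ (g : G) (x : X), f (g • x) = f x := by
  constructor
  · intro h
    let H : Subgroup G :=
      { carrier := {g | ∀ x, f (g • x) = f x}
        one_mem' := by simp
        mul_mem' := fun {a b} ha hb x => by rw [mul_smul, ha, hb]
        inv_mem' := fun {a} ha x => by rw [← ha, smul_inv_smul] }
    have hmem : σ⁻¹ ∈ H := fun x => sub_eq_zero.1 (congrFun h x)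
    have : Subgroup.zpowers σ ≤ H := by
      rw [Subgroup.zpowers_le]
      simpa using H.inv_mem hmem
    exact fun g => this (hσ g)
  · intro h
    ext x
    simp [permDiff_apply, h]

/-- Moving a basis vector within its orbit changes it by an element of the image of `σ - 1`. -/
theorem single_smul_sub_single_mem_range [DecidableEq X] {σ : G}
    (hσ : ∀ g, g ∈ Subgroup.zpowers σ) (g : G) (x : X) :
    Pi.single (g • x) (1 : ℤ) - Pi.single x 1 ∈ (permDiff X σ).range := by
  let H : Subgroup G :=
    { carrier := {g | ∀ x : X, Pi.single (g • x) (1 : ℤ) - Pi.single x 1 ∈ (permDiff X σ).range}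
      one_mem' := fun x => by simp
      mul_mem' := fun {a b} ha hb x => by
        have := add_mem (ha (b • x)) (hb x)
        rwa [sub_add_sub_cancel, smul_smul] at this
      inv_mem' := fun {a} ha x => by
        have := neg_mem (ha (a⁻¹ • x))
        rwa [smul_inv_smul, neg_sub] at this }
  have hmem : σ ∈ H := fun x => ⟨Pi.single x 1, by
    ext y
    simp [permDiff_apply, Pi.single_apply, inv_smul_eq_iff]⟩
  exact (Subgroup.zpowers_le.2 hmem) (hσ g) x

theorem card_filter_smul_eq [Fintype G] [DecidableEq X] (x : X) (g₀ : G) :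
    (Finset.univ.filter fun g : G => g • x = g₀ • x).card =
      Nat.card (MulAction.stabilizer G x) := by
  rw [← Fintype.card_subtype, ← Nat.card_eq_fintype_card]
  refine Nat.card_congr ((Equiv.mulLeft g₀⁻¹).subtypeEquiv fun g => ?_)
  rw [Equiv.coe_mulLeft, MulAction.mem_stabilizer_iff, mul_smul, inv_smul_eq_iff]

variable [Fintype G] {ι : Type*} [Fintype ι] (r : ι → X) (i : X → ι)

/-- The degree one Tate cohomology of a permutation module of a cyclic group vanishes. The map `r`
picks a point in each orbit and `i` sends a point to the index of its orbit. -/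
theorem ker_permNorm_le_range_permDiff [Fintype X] {σ : G} (hσ : ∀ g, g ∈ Subgroup.zpowers σ)
    (hr : ∀ x, ∃ g : G, g • x = r (i x)) (hi : ∀ (g : G) x, i (g • x) = i x) :
    (permNorm G X).ker ≤ (permDiff X σ).range := by
  classical
  intro f hf
  have hf' : ∀ x, ∑ g : G, f (g • x) = 0 := fun x => congrFun hf x
  -- the total mass of `f` on each orbit vanishes
  have hsum : ∀ j, ∑ x with i x = j, f x = 0 := by
    intro j
    have h1 : ∀ g : G, ∑ x with i x = j, f (g • x) = ∑ x with i x = j, f x := fun g =>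
      Finset.sum_equiv (MulAction.toPerm g) (by simp [hi]) (by simp)
    have h2 : ∑ g : G, ∑ x with i x = j, f (g • x) = 0 := by
      rw [Finset.sum_comm]
      exact Finset.sum_eq_zero fun x _ => hf' x
    simpa [h1] using h2
  choose g hg using hr
  have h3 : ∑ x, f x • (Pi.single (r (i x)) (1 : ℤ) - Pi.single x 1 : X → ℤ) ∈
      (permDiff X σ).range := by
    refine sum_mem fun x _ => zsmul_mem ?_ _
    rw [← hg]
    exact single_smul_sub_single_mem_range hσ _ _
  have h4 : ∑ x, f x • (Pi.single (r (i x)) (1 : ℤ) : X → ℤ) = 0 := by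
    rw [← Finset.sum_fiberwise (s := Finset.univ) (g := i)]
    refine Finset.sum_eq_zero fun j _ => ?_
    rw [Finset.sum_congr rfl (g := fun x => f x • (Pi.single (r j) (1 : ℤ) : X → ℤ)),
      ← Finset.sum_smul, hsum, zero_smul]
    intro x hx
    rw [(Finset.mem_filter.1 hx).2]
  have h5 : ∑ x, f x • (Pi.single x (1 : ℤ) : X → ℤ) = f := by
    ext y
    simp [Finset.sum_apply, Pi.single_apply]
  simp_rw [smul_sub, Finset.sum_sub_distrib] at h3
  rw [h4, h5, zero_sub] at h3
  simpa using h3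

/-- The degree zero Tate cohomology of a permutation module: one cyclic group for each orbit, of
order the order of the stabilizer. -/
theorem relIndex_permNorm_range {σ : G} (hσ : ∀ g, g ∈ Subgroup.zpowers σ)
    (hr : ∀ x, ∃ g : G, g • x = r (i x)) (hi : ∀ (g : G) x, i (g • x) = i x)
    (hir : ∀ j, i (r j) = j) :
    (permNorm G X).range.relIndex (permDiff X σ).ker =
      ∏ j, Nat.card (MulAction.stabilizer G (r j)) := by
  classical
  -- invariant functions, evaluated at the orbit representatives modulo the stabilizer orders
  let ev : (X → ℤ) →+ (∀ j : ι, ZMod (Nat.card (MulAction.stabilizer G (r j)))) :=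
    { toFun := fun f j => (f (r j) : ZMod _)
      map_zero' := by ext; simp
      map_add' := fun f g => by ext; simp }
  have hker : ∀ f ∈ (permDiff X σ).ker, f ∈ ev.ker ↔ f ∈ (permNorm G X).range := by
    intro f hf
    have hf' := (permDiff_eq_zero_iff hσ f).1 hf
    have hev : f ∈ ev.ker ↔ ∀ j, (Nat.card (MulAction.stabilizer G (r j)) : ℤ) ∣ f (r j) := by
      simp only [AddMonoidHom.mem_ker, funext_iff, ← ZMod.intCast_zmod_eq_zero_iff_dvd]
      rfl
    rw [hev]
    constructor
    · intro h
      choose c hc using h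
      -- an invariant function is the norm of one supported on the orbit representatives
      refine ⟨∑ j, c j • Pi.single (r j) 1, ?_⟩
      ext x
      obtain ⟨g₀, hg₀⟩ := hr x
      rw [← hf' g₀ x, hg₀, hc, permNorm_apply]
      have h1 : ∀ g : G, (∑ j, c j • (Pi.single (r j) (1 : ℤ) : X → ℤ)) (g • x) =
          if g • x = r (i x) then c (i x) else 0 := by
        intro g
        rw [Finset.sum_apply, Finset.sum_eq_single (i x)]
        · simp [Pi.single_apply]
        · intro j _ hj
          have : g • x ≠ r j := fun h => hj (by rw [← hir j, ← h, hi])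
          simp [this]
        · simp
      have h2 : x = g₀⁻¹ • r (i x) := by rw [← hg₀, inv_smul_smul]
      have h3 := card_filter_smul_eq x g₀
      rw [hg₀] at h3
      have h4 : Nat.card (MulAction.stabilizer G (r (i x))) =
          Nat.card (MulAction.stabilizer G x) := by
        rw [← hg₀]
        exact Nat.card_congr (MulAction.stabilizerEquivStabilizer rfl).symm.toEquiv
      simp_rw [h1]
      rw [← Finset.sum_filter, Finset.sum_const, h3, h4, nsmul_eq_mul]
    · rintro ⟨h, rfl⟩ j
      rw [permNorm_apply, Finset.sum_comp h (fun g : G => g • r j)]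
      refine Finset.dvd_sum fun x hx => ?_
      obtain ⟨g₀, -, rfl⟩ := Finset.mem_image.1 hx
      refine Dvd.intro (h (g₀ • r j)) ?_
      rw [← card_filter_smul_eq (r j) g₀, nsmul_eq_mul]
  have h1 : (permNorm G X).range.relIndex (permDiff X σ).ker =
      ev.ker.relIndex (permDiff X σ).ker := by
    rw [← AddSubgroup.inf_relIndex_right, ← AddSubgroup.inf_relIndex_right ev.ker]
    congr 1
    ext f
    simp only [AddSubgroup.mem_inf]
    exact and_congr_left fun hf => (hker f hf).symm
  have h2 : (permDiff X σ).ker.map ev = ⊤ := by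
    rw [eq_top_iff]
    intro c _
    let d : ι → ℤ := fun j => (c j).cast
    refine ⟨fun x => d (i x), ?_, ?_⟩
    · exact (permDiff_eq_zero_iff hσ _).2 fun g x => by simp only [hi]
    · ext j
      have : NeZero (Nat.card (MulAction.stabilizer G (r j))) := ⟨Nat.card_pos.ne'⟩
      change (d (i (r j)) : ZMod _) = c j
      rw [hir j]
      simp [d]
  rw [h1, AddSubgroup.relIndex_ker, h2]
  rw [AddSubgroup.card_top, Nat.card_pi]
  simp

end Permutation

/-! ### Divisors, orders at primes and ideal classes -/

section Divisors

open WithZero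

variable {R : Type*} (K : Type*) [CommRing R] [IsDedekindDomain R] [Field K] [Algebra R K]
  [IsFractionRing R K]

/-- The order of an element of `Kˣ` at a nonzero prime, as a homomorphism to `ℤ`: the exponent of
the prime in the factorization of the principal fractional ideal. -/
def ord (P : HeightOneSpectrum R) : Additive Kˣ →+ ℤ where
  toFun x := FractionalIdeal.count K P (FractionalIdeal.spanSingleton R⁰ (x.toMul : K))
  map_zero' := by simp [FractionalIdeal.count_one]
  map_add' x y := by
    rw [toMul_add, Units.val_mul, ← FractionalIdeal.spanSingleton_mul_spanSingleton,
      FractionalIdeal.count_mul] <;>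
    exact FractionalIdeal.spanSingleton_ne_zero_iff.2 (Units.ne_zero _)

variable {K}

theorem ord_apply (P : HeightOneSpectrum R) (x : Kˣ) : ord K P (Additive.ofMul x) =
    FractionalIdeal.count K P (FractionalIdeal.spanSingleton R⁰ (x : K)) := rfl

theorem valuation_eq_exp_neg_ord (P : HeightOneSpectrum R) (x : Kˣ) :
    P.valuation K (x : K) = exp (-ord K P (Additive.ofMul x)) := by
  classical
  have hint : ∀ (a : R) (ha : algebraMap R K a ≠ 0), P.valuation K (algebraMap R K a) =
      exp (-ord K P (Additive.ofMul (Units.mk0 _ ha))) := by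
    intro a ha
    have ha' : a ≠ 0 := fun h => ha (by rw [h, map_zero])
    rw [HeightOneSpectrum.valuation_of_algebraMap, ord_apply, Units.val_mk0,
      ← FractionalIdeal.coeIdeal_span_singleton, FractionalIdeal.count_coe _ _ (by simpa),
      HeightOneSpectrum.intValuation_if_neg _ ha']
  obtain ⟨a, b, hb, h⟩ := IsFractionRing.div_surjective (A := R) (x : K)
  have hb0 : algebraMap R K b ≠ 0 := IsFractionRing.to_map_ne_zero_of_mem_nonZeroDivisors hb
  have ha0 : algebraMap R K a ≠ 0 := by
    intro h0
    rw [h0, zero_div] at h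
    exact x.ne_zero h.symm
  have hx : x = Units.mk0 _ ha0 / Units.mk0 _ hb0 := by
    ext
    simp [h]
  rw [← h, map_div₀, hint a ha0, hint b hb0, hx, ofMul_div, map_sub, ← exp_sub]
  congr 1
  ring

theorem valuation_eq_one_iff_ord_eq_zero (P : HeightOneSpectrum R) (x : Kˣ) :
    P.valuation K (x : K) = 1 ↔ ord K P (Additive.ofMul x) = 0 := by
  rw [valuation_eq_exp_neg_ord, ← exp_zero, exp_inj, neg_eq_zero]

theorem finite_support_ord (x : Additive Kˣ) :
    {P : HeightOneSpectrum R | ord K P x ≠ 0}.Finite :=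
  FractionalIdeal.finite_factors _

variable (R)

/-- The ideal class of a divisor. -/
def divClass : (HeightOneSpectrum R →₀ ℤ) →+ Additive (ClassGroup R) :=
  Finsupp.liftAddHom fun p => zmultiplesHom _ (Additive.ofMul
    (ClassGroup.mk0 ⟨p.asIdeal, mem_nonZeroDivisors_of_ne_zero p.ne_bot⟩))

variable {R}

theorem divClass_single (p : HeightOneSpectrum R) (n : ℤ) :
    divClass R (Finsupp.single p n) = n • Additive.ofMul
      (ClassGroup.mk0 ⟨p.asIdeal, mem_nonZeroDivisors_of_ne_zero p.ne_bot⟩) := by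
  simp [divClass]

variable (K)

/-- The fractional ideal of a divisor represents its class. -/
theorem divClass_eq_mk (D : HeightOneSpectrum R →₀ ℤ) (I : (FractionalIdeal R⁰ K)ˣ)
    (hI : ∀ p, FractionalIdeal.count K p (I : FractionalIdeal R⁰ K) = D p) :
    divClass R D = Additive.ofMul (ClassGroup.mk K I) := by
  let u : HeightOneSpectrum R → (FractionalIdeal R⁰ K)ˣ := fun p =>
    FractionalIdeal.mk0 K ⟨p.asIdeal, mem_nonZeroDivisors_of_ne_zero p.ne_bot⟩
  have h1 : I = D.prod fun p n => u p ^ n := by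
    ext1
    rw [← FractionalIdeal.finprod_heightOneSpectrum_factorization' K I.ne_zero,
      finprod_eq_prod_of_mulSupport_subset (s := D.support), Finsupp.prod, Units.coe_prod]
    · refine Finset.prod_congr rfl fun p _ => ?_
      rw [hI, Units.val_zpow_eq_zpow_val]
      rfl
    · intro p hp
      rw [Function.mem_mulSupport] at hp
      simp only [Finset.mem_coe, Finsupp.mem_support_iff]
      intro h
      exact hp (by rw [hI, h, zpow_zero])
  rw [h1, map_finsuppProd]
  simp only [divClass, Finsupp.liftAddHom_apply, zmultiplesHom_apply, Finsupp.sum, Finsupp.prod,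
    map_zpow, u, ClassGroup.mk_mk0, ofMul_prod, ofMul_zpow]

/-- A divisor has trivial class if and only if it is the divisor of an element. -/
theorem divClass_eq_zero_iff (D : HeightOneSpectrum R →₀ ℤ) :
    divClass R D = 0 ↔ ∃ x : Kˣ, ∀ p, ord K p (Additive.ofMul x) = D p := by
  constructor
  · intro h
    have hD0 : (D.prod fun p n => (p.asIdeal : FractionalIdeal R⁰ K) ^ n) ≠ 0 :=
      Finset.prod_ne_zero_iff.2 fun p _ => zpow_ne_zero _
        (FractionalIdeal.coeIdeal_ne_zero.mpr p.ne_bot)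
    rw [divClass_eq_mk K D (Units.mk0 _ hD0)
      (fun p => FractionalIdeal.count_finsuppProd K p D)] at h
    obtain ⟨x, hx⟩ := (FractionalIdeal.isPrincipal_iff _).1
      (ClassGroup.mk_eq_one_iff.1 (ofMul_eq_zero.1 h))
    rw [Units.val_mk0] at hx
    have hx0 : x ≠ 0 := by
      rintro rfl
      exact hD0 (by rw [hx, FractionalIdeal.spanSingleton_zero])
    refine ⟨Units.mk0 x hx0, fun p => ?_⟩
    rw [ord_apply, Units.val_mk0, ← hx, FractionalIdeal.count_finsuppProd]
  · rintro ⟨x, hx⟩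
    rw [divClass_eq_mk K D (toPrincipalIdeal R K x)
      (fun p => by rw [coe_toPrincipalIdeal, ← hx, ord_apply]), ofMul_eq_zero,
      ClassGroup.mk_eq_one_iff, coe_toPrincipalIdeal, FractionalIdeal.isPrincipal_iff]
    exact ⟨x, rfl⟩

theorem divClass_surjective : Function.Surjective (divClass R) := by
  intro c
  refine ClassGroup.induction (FractionRing R) (P := fun c => ∃ D, divClass R D = Additive.ofMul c)
    (fun I => ?_) c.toMul
  have hf : {p : HeightOneSpectrum R | FractionalIdeal.count (FractionRing R) p
      (I : FractionalIdeal R⁰ (FractionRing R)) ≠ 0}.Finite := FractionalIdeal.finite_factors _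
  exact ⟨Finsupp.ofSupportFinite _ hf, divClass_eq_mk (FractionRing R) _ I fun p => rfl⟩

end Divisors

/-! ### The Galois action on places -/

section Places

set_option linter.unusedSectionVars false

variable {F K : Type*} [Field F] [NumberField F] [Field K] [NumberField K] [Algebra F K]
  [IsGalois F K]

/-- The Galois group acts on the nonzero primes of `K`; together with Mathlib's action on the
infinite places this gives its action on `Place K`. -/
instance : MulAction Gal(K/F) (HeightOneSpectrum (𝓞 K)) where
  smul := smulPrime
  one_smul P := HeightOneSpectrum.ext (one_smul _ P.asIdeal)
  mul_smul σ τ P := HeightOneSpectrum.ext (mul_smul σ τ P.asIdeal)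

theorem asIdeal_smul (σ : Gal(K/F)) (P : HeightOneSpectrum (𝓞 K)) :
    (σ • P).asIdeal = σ • P.asIdeal := rfl

theorem ord_smul (σ : Gal(K/F)) (P : HeightOneSpectrum (𝓞 K)) (x : Kˣ) :
    ord K (σ • P) (Additive.ofMul (σ • x)) = ord K P (Additive.ofMul x) := by
  have h := valuation_smul σ P (x : K)
  have h2 : σ (x : K) = ((σ • x : Kˣ) : K) := rfl
  rw [h2, valuation_eq_exp_neg_ord, valuation_eq_exp_neg_ord, WithZero.exp_inj, neg_inj] at h
  exact h

theorem ord_smul' (σ : Gal(K/F)) (P : HeightOneSpectrum (𝓞 K)) (x : Kˣ) :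
    ord K P (Additive.ofMul (σ • x)) = ord K (σ⁻¹ • P) (Additive.ofMul x) := by
  rw [← ord_smul σ (σ⁻¹ • P), smul_inv_smul]

variable (F) in
/-- The prime of `F` below a nonzero prime of `K`. -/
def primeUnder (P : HeightOneSpectrum (𝓞 K)) : HeightOneSpectrum (𝓞 F) where
  asIdeal := P.asIdeal.under (𝓞 F)
  isPrime := inferInstance
  ne_bot := mt Ideal.eq_bot_of_comap_eq_bot P.ne_bot

instance (P : HeightOneSpectrum (𝓞 K)) : P.asIdeal.LiesOver (primeUnder F P).asIdeal := ⟨rfl⟩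

theorem liesOver_iff_primeUnder_eq (P : HeightOneSpectrum (𝓞 K)) (p : HeightOneSpectrum (𝓞 F)) :
    P.asIdeal.LiesOver p.asIdeal ↔ primeUnder F P = p :=
  ⟨fun h => HeightOneSpectrum.ext h.over.symm, fun h => h ▸ inferInstance⟩

theorem primeUnder_smul (σ : Gal(K/F)) (P : HeightOneSpectrum (𝓞 K)) :
    primeUnder F (σ • P) = primeUnder F P :=
  HeightOneSpectrum.ext (Ideal.under_smul _ _ _)

theorem exists_primeUnder_eq (p : HeightOneSpectrum (𝓞 F)) :
    ∃ P : HeightOneSpectrum (𝓞 K), primeUnder F P = p := by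
  obtain ⟨P, hP, hPv⟩ := p.asIdeal.exists_ideal_over_prime_of_isIntegral_of_isDomain
    (S := 𝓞 K) (by simp)
  exact ⟨⟨P, hP, fun h => p.ne_bot (by rw [← hPv, h, Ideal.comap_bot_of_injective _
      (FaithfulSMul.algebraMap_injective _ _)])⟩, HeightOneSpectrum.ext hPv⟩

theorem exists_smul_eq_of_primeUnder_eq {P Q : HeightOneSpectrum (𝓞 K)}
    (h : primeUnder F P = primeUnder F Q) : ∃ σ : Gal(K/F), σ • P = Q := by
  have : Q.asIdeal.LiesOver (primeUnder F P).asIdeal := (liesOver_iff_primeUnder_eq _ _).2 h.symm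
  obtain ⟨σ, hσ⟩ := Ideal.exists_smul_eq_of_isGaloisGroup (primeUnder F P).asIdeal P.asIdeal
    Q.asIdeal Gal(K/F)
  exact ⟨σ, HeightOneSpectrum.ext hσ⟩

theorem ord_algebraMap (P : HeightOneSpectrum (𝓞 K)) (x : Fˣ) :
    ord K P (Additive.ofMul (Units.map (algebraMap F K).toMonoidHom x)) =
      (primeUnder F P).asIdeal.ramificationIdx' P.asIdeal *
        ord F (primeUnder F P) (Additive.ofMul x) := by
  have h := HeightOneSpectrum.valuation_liesOver K (primeUnder F P) P (x : F)
  have h2 : algebraMap F K x = ((Units.map (algebraMap F K).toMonoidHom x : Kˣ) : K) := rfl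
  rw [h2, valuation_eq_exp_neg_ord, valuation_eq_exp_neg_ord, ← WithZero.exp_nsmul,
    WithZero.exp_inj, smul_neg, neg_inj, nsmul_eq_mul] at h
  exact h.symm

theorem ramificationIdx'_primeUnder_ne_zero (P : HeightOneSpectrum (𝓞 K)) :
    ((primeUnder F P).asIdeal.ramificationIdx' P.asIdeal : ℤ) ≠ 0 :=
  Nat.cast_ne_zero.2 (Ideal.IsDedekindDomain.ramificationIdx'_ne_zero_of_liesOver P.asIdeal
    (primeUnder F P).ne_bot)

theorem mem_SUnits_iff {S : Set (Place F)} {x : Fˣ} :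
    x ∈ SUnits F S ↔ ∀ p, Sum.inl p ∉ S → ord F p (Additive.ofMul x) = 0 := by
  simp only [← valuation_eq_one_iff_ord_eq_zero]
  rfl

theorem inl_mem_above_iff {S : Set (Place F)} {P : HeightOneSpectrum (𝓞 K)} :
    (Sum.inl P : Place K) ∈ above K S ↔ Sum.inl (primeUnder F P) ∈ S := by
  constructor
  · rintro ⟨p | v, hv, h⟩
    · rwa [(liesOver_iff_primeUnder_eq P p).1 h]
    · exact h.elim
  · intro h
    exact ⟨_, h, (inferInstance : P.asIdeal.LiesOver (primeUnder F P).asIdeal)⟩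

theorem liesAbove_smul_iff {σ : Gal(K/F)} {w : Place K} {v : Place F} :
    LiesAbove (σ • w) v ↔ LiesAbove w v := by
  rcases w with P | w <;> rcases v with p | v
  · change (σ • P).asIdeal.LiesOver _ ↔ P.asIdeal.LiesOver _
    rw [liesOver_iff_primeUnder_eq, liesOver_iff_primeUnder_eq, primeUnder_smul]
  · rfl
  · rfl
  · change (σ • w).comap _ = v ↔ w.comap _ = v
    have : (σ • w).comap (algebraMap F K) = w.comap (algebraMap F K) := by
      ext x
      simp
    rw [this]

theorem LiesAbove.unique {w : Place K} {v v' : Place F} (h : LiesAbove w v) (h' : LiesAbove w v') :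
    v = v' := by
  rcases w with P | w <;> rcases v with p | v <;> rcases v' with p' | v'
  all_goals first | exact h.elim | exact h'.elim | skip
  · rw [← (liesOver_iff_primeUnder_eq P p).1 h, ← (liesOver_iff_primeUnder_eq P p').1 h']
  · exact congrArg Sum.inr (Eq.trans (Eq.symm h) h')

theorem LiesAbove.exists_smul_eq {w w' : Place K} {v : Place F}
    (h : LiesAbove w v) (h' : LiesAbove w' v) : ∃ σ : Gal(K/F), σ • w = w' := by
  rcases v with p | v <;> rcases w with P | w <;> rcases w' with P' | w'
  all_goals first | exact h.elim | exact h'.elim | skip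
  · obtain ⟨σ, hσ⟩ := exists_smul_eq_of_primeUnder_eq
      (((liesOver_iff_primeUnder_eq P p).1 h).trans ((liesOver_iff_primeUnder_eq P' p).1 h').symm)
    exact ⟨σ, congrArg Sum.inl hσ⟩
  · obtain ⟨σ, hσ⟩ := InfinitePlace.exists_smul_eq_of_comap_eq (k := F) (Eq.trans h (Eq.symm h'))
    exact ⟨σ, congrArg Sum.inr hσ⟩

theorem decompositionGroup_eq_stabilizer (w : Place K) :
    decompositionGroup F w = MulAction.stabilizer Gal(K/F) w := by
  rcases w with P | w <;> ext σ
  · change σ • P.asIdeal = P.asIdeal ↔ Sum.inl (σ • P) = Sum.inl P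
    rw [Sum.inl.injEq, HeightOneSpectrum.ext_iff, asIdeal_smul]
  · change σ • w = w ↔ Sum.inr (σ • w) = Sum.inr w
    rw [Sum.inr.injEq]

theorem finite_above (S : Set (Place F)) (hS : S.Finite) : (above K S).Finite := by
  have h1 : above K S = ⋃ v ∈ S, {w : Place K | LiesAbove w v} := by
    ext w
    simp [above]
  rw [h1]
  refine hS.biUnion fun v _ => ?_
  rcases v with p | v
  · have : {w : Place K | LiesAbove w (Sum.inl p : Place F)} ⊆
        Sum.inl '' (HeightOneSpectrum.asIdeal ⁻¹' (p.asIdeal.primesOver (𝓞 K))) := by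
      rintro (P | w) h
      · exact ⟨P, ⟨P.isPrime, h⟩, rfl⟩
      · exact h.elim
    have : p.asIdeal.IsMaximal := p.isMaximal
    exact (((IsDedekindDomain.primesOver_finite p.asIdeal (𝓞 K)).preimage
      (fun a _ b _ h => HeightOneSpectrum.ext h)).image _).subset ‹_›
  · refine (Set.finite_range (Sum.inr : InfinitePlace K → Place K)).subset ?_
    rintro (P | w) h
    · exact h.elim
    · exact ⟨w, rfl⟩

instance (S : Set (Place F)) : MulAction Gal(K/F) (above K S) where
  smul σ w := ⟨σ • w.1, by
    obtain ⟨v, hv, h⟩ := w.2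
    exact ⟨v, hv, liesAbove_smul_iff.2 h⟩⟩
  one_smul w := Subtype.ext (one_smul _ w.1)
  mul_smul σ τ w := Subtype.ext (mul_smul σ τ w.1)

/-! ### The Galois module of `S`-units -/

theorem smul_mem_SUnits {S : Set (Place F)} (σ : Gal(K/F)) {x : Kˣ}
    (hx : x ∈ SUnits K (above K S)) : σ • x ∈ SUnits K (above K S) := by
  rw [mem_SUnits_iff] at hx ⊢
  intro P hP
  rw [ord_smul']
  refine hx _ ?_
  rwa [inl_mem_above_iff, primeUnder_smul, ← inl_mem_above_iff]

variable (S : Set (Place F))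

/-- The action of an element of the Galois group on the group of `S`-units, written additively. -/
def sUnitsAct (σ : Gal(K/F)) :
    Additive (SUnits K (above K S)) →+ Additive (SUnits K (above K S)) where
  toFun x := Additive.ofMul ⟨σ • (x.toMul : Kˣ), smul_mem_SUnits σ x.toMul.2⟩
  map_zero' := by
    refine congrArg Additive.ofMul (Subtype.ext ?_)
    exact smul_one σ
  map_add' x y := by
    refine congrArg Additive.ofMul (Subtype.ext ?_)
    exact smul_mul' σ _ _

/-- The operator `σ - 1` on the group of `S`-units, written additively. -/
def sUnitsDiff (σ : Gal(K/F)) :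
    Additive (SUnits K (above K S)) →+ Additive (SUnits K (above K S)) :=
  sUnitsAct S σ - AddMonoidHom.id _

/-- The norm `∑ g` on the group of `S`-units, written additively. -/
def sUnitsNorm (F K : Type*) [Field F] [NumberField F] [Field K] [NumberField K] [Algebra F K]
    [IsGalois F K] (S : Set (Place F)) :
    Additive (SUnits K (above K S)) →+ Additive (SUnits K (above K S)) :=
  ∑ g : Gal(K/F), sUnitsAct S g

theorem sUnitsAct_mul (σ τ : Gal(K/F)) (x : Additive (SUnits K (above K S))) :
    sUnitsAct S (σ * τ) x = sUnitsAct S σ (sUnitsAct S τ x) :=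
  congrArg Additive.ofMul (Subtype.ext (mul_smul σ τ (x.toMul : Kˣ)))

theorem sUnitsDiff_apply (σ : Gal(K/F)) (x : Additive (SUnits K (above K S))) :
    sUnitsDiff S σ x = sUnitsAct S σ x - x := rfl

theorem sUnitsNorm_apply (x : Additive (SUnits K (above K S))) :
    sUnitsNorm F K S x = ∑ g : Gal(K/F), sUnitsAct S g x := by
  simp [sUnitsNorm]

theorem sUnitsDiff_sUnitsNorm (σ : Gal(K/F)) (x : Additive (SUnits K (above K S))) :
    sUnitsDiff S σ (sUnitsNorm F K S x) = 0 := by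
  rw [sUnitsDiff_apply, sUnitsNorm_apply, map_sum, sub_eq_zero]
  simp_rw [← sUnitsAct_mul]
  exact Fintype.sum_equiv (Equiv.mulLeft σ) _ _ fun _ => rfl

theorem sUnitsNorm_sUnitsDiff (σ : Gal(K/F)) (x : Additive (SUnits K (above K S))) :
    sUnitsNorm F K S (sUnitsDiff S σ x) = 0 := by
  rw [sUnitsDiff_apply, map_sub, sUnitsNorm_apply, sUnitsNorm_apply, sub_eq_zero]
  simp_rw [← sUnitsAct_mul]
  exact Fintype.sum_equiv (Equiv.mulRight σ) _ _ fun _ => rfl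

theorem coe_sUnitsNorm (x : Additive (SUnits K (above K S))) :
    (((sUnitsNorm F K S x).toMul : Kˣ) : K) = ∏ g : Gal(K/F), g ((x.toMul : Kˣ) : K) := by
  rw [sUnitsNorm_apply, toMul_sum, Subgroup.val_finsetProd, Units.coe_prod]
  rfl

end Places

/-! ### Hilbert's theorem 90 -/

/-- Hilbert's theorem 90 for a cyclic extension, for fields in arbitrary universes. -/
theorem exists_smul_div_eq_of_prod_eq_one {F K : Type*} [Field F] [Field K] [Algebra F K]
    [FiniteDimensional F K] {σ : Gal(K/F)} (hσ : ∀ g, g ∈ Subgroup.zpowers σ) (u : Kˣ)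
    (hu : ∏ g : Gal(K/F), g (u : K) = 1) : ∃ x : Kˣ, σ • x / x = u := by
  classical
  let n := orderOf σ
  have himage : (Finset.range n).image (fun i => σ ^ i) = Finset.univ :=
    IsCyclic.image_range_orderOf hσ
  have hinj : Set.InjOn (fun i => σ ^ i) (Finset.range n : Set ℕ) := fun i hi j hj h =>
    pow_injOn_Iio_orderOf (by simpa using hi) (by simpa using hj) h
  -- the values `u, u σ(u), u σ(u) σ²(u), …` of the cocycle attached to `u`
  let c : ℕ → K := fun i => ∏ j ∈ Finset.range i, (σ ^ j) (u : K)
  have hc0 : c 0 = 1 := by simp [c]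
  have hcn : c n = 1 := by
    rw [← hu, ← himage, Finset.prod_image hinj]
  have hcs : ∀ i, (u : K) * σ (c i) = c (i + 1) := by
    intro i
    simp only [c]
    rw [Finset.prod_range_succ', map_prod, mul_comm]
    simp [pow_succ']
  -- by independence of characters some resolvent `∑ c i * σ ^ i z` is nonzero
  obtain ⟨z, hz⟩ : ∃ z : K, ∑ i ∈ Finset.range n, c i * (σ ^ i) z ≠ 0 := by
    by_contra! h
    have hli : LinearIndependent K (fun i : Fin n => ((σ ^ (i : ℕ) : Gal(K/F)) : K → K)) := by
      refine (linearIndependent_monoidHom K K).comp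
        (fun i : Fin n => ((σ ^ (i : ℕ) : Gal(K/F)) : K →* K)) fun i j hij => ?_
      refine Fin.ext (hinj (by simp) (by simp) ?_)
      ext x
      exact DFunLike.congr_fun hij x
    have h0 := Fintype.linearIndependent_iff.1 hli (fun i => c i) (by
      ext z
      rw [Finset.sum_apply, Pi.zero_apply, ← h z, ← Fin.sum_univ_eq_sum_range
        (fun i => c i * (σ ^ i) z)]
      rfl) ⟨0, orderOf_pos σ⟩
    exact one_ne_zero (hc0.symm.trans h0)
  set y := ∑ i ∈ Finset.range n, c i * (σ ^ i) z with hy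
  have hfix : (u : K) * σ y = y := by
    have h1 : (u : K) * σ y = ∑ i ∈ Finset.range n, c (i + 1) * (σ ^ (i + 1)) z := by
      rw [hy, map_sum, Finset.mul_sum]
      refine Finset.sum_congr rfl fun i _ => ?_
      rw [map_mul, ← mul_assoc, hcs, pow_succ']
      rfl
    have h2 := Finset.sum_range_succ (fun i => c i * (σ ^ i) z) n
    rw [Finset.sum_range_succ'] at h2
    rw [h1, hy]
    have h3 : σ ^ n = 1 := pow_orderOf_eq_one σ
    rw [hc0, hcn, h3, pow_zero] at h2
    exact add_right_cancel h2
  refine ⟨(Units.mk0 y hz)⁻¹, ?_⟩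
  ext
  have h4 : σ y ≠ 0 := by simpa using hz
  have h5 : ((σ • (Units.mk0 y hz)⁻¹ / (Units.mk0 y hz)⁻¹ : Kˣ) : K) = (σ y)⁻¹ / y⁻¹ := by
    rw [smul_inv', Units.val_div_eq_div_val, Units.val_inv_eq_inv_val, Units.val_inv_eq_inv_val]
    rfl
  rw [h5]
  field_simp
  rw [mul_comm]
  exact hfix.symm

section Classes

set_option linter.unusedSectionVars false

/-! ### `S`-ideal classes and the capitulation map -/

/-- A divisor has trivial `S`-class if and only if it is principal outside `S`. -/
theorem mk_divClass_eq_one_iff {L : Type*} [Field L] [NumberField L] (S : Set (Place L))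
    (D : HeightOneSpectrum (𝓞 L) →₀ ℤ) :
    (QuotientGroup.mk (divClass (𝓞 L) D).toMul : SClassGroup L S) = 1 ↔
      ∃ x : Lˣ, ∀ p, Sum.inl p ∉ S → ord L p (Additive.ofMul x) = D p := by
  rw [QuotientGroup.eq_one_iff]
  constructor
  · intro h
    have key : ∃ D' : HeightOneSpectrum (𝓞 L) →₀ ℤ, (∀ p, Sum.inl p ∉ S → D' p = 0) ∧
        (divClass (𝓞 L) D').toMul = (divClass (𝓞 L) D).toMul := by
      refine Subgroup.closure_induction (p := fun c _ => ∃ D' : HeightOneSpectrum (𝓞 L) →₀ ℤ,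
        (∀ p, Sum.inl p ∉ S → D' p = 0) ∧ (divClass (𝓞 L) D').toMul = c) ?_ ?_ ?_ ?_ h
      · rintro _ ⟨q, hq, rfl⟩
        refine ⟨Finsupp.single q 1, fun p hp => ?_, ?_⟩
        · refine Finsupp.single_eq_of_ne ?_
          rintro rfl
          exact hp hq
        · rw [divClass_single, one_zsmul, toMul_ofMul]
      · exact ⟨0, fun _ _ => rfl, by rw [map_zero, toMul_zero]⟩
      · rintro _ _ _ _ ⟨D₁, h₁, rfl⟩ ⟨D₂, h₂, rfl⟩
        exact ⟨D₁ + D₂, fun p hp => by simp [h₁ p hp, h₂ p hp],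
          by rw [(divClass _).map_add, toMul_add]⟩
      · rintro _ _ ⟨D₁, h₁, rfl⟩
        exact ⟨-D₁, fun p hp => by simp [h₁ p hp], by rw [map_neg, toMul_neg]⟩
    obtain ⟨D', hD', h'⟩ := key
    have h0 : divClass (𝓞 L) (D - D') = 0 := by
      rw [map_sub, sub_eq_zero]
      exact Additive.toMul.injective h'.symm
    obtain ⟨x, hx⟩ := (divClass_eq_zero_iff L _).1 h0
    exact ⟨x, fun p hp => by rw [hx, Finsupp.sub_apply, hD' p hp, sub_zero]⟩
  · rintro ⟨x, hx⟩
    let E : HeightOneSpectrum (𝓞 L) →₀ ℤ := Finsupp.ofSupportFinite _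
      (finite_support_ord (Additive.ofMul x))
    have hE : divClass (𝓞 L) E = 0 := (divClass_eq_zero_iff L _).2 ⟨x, fun p => rfl⟩
    have h1 : divClass (𝓞 L) D = divClass (𝓞 L) (D - E) := by rw [map_sub, hE, sub_zero]
    rw [h1, ← Finsupp.sum_single (D - E), Finsupp.sum, map_sum, toMul_sum]
    refine prod_mem fun p hp => ?_
    rw [divClass_single, toMul_zsmul]
    have hmem : Sum.inl p ∈ S → ClassGroup.mk0 ⟨p.asIdeal,
        mem_nonZeroDivisors_of_ne_zero p.ne_bot⟩ ∈ primeClasses L S :=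
      fun hp => Subgroup.subset_closure ⟨p, hp, rfl⟩
    refine zpow_mem (hmem ?_) _
    by_contra hpS
    refine Finsupp.mem_support_iff.1 hp ?_
    rw [Finsupp.sub_apply, ← hx p hpS]
    exact sub_self _

variable {F K : Type*} [Field F] [NumberField F] [Field K] [NumberField K] [Algebra F K]
  [IsGalois F K]

/-- Extension of ideals on divisors: the exponent at a prime is multiplied by the ramification
index. -/
theorem exists_divClass_eq_extendedHom (D : HeightOneSpectrum (𝓞 F) →₀ ℤ) :
    ∃ D' : HeightOneSpectrum (𝓞 K) →₀ ℤ,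
      (∀ P, D' P = (primeUnder F P).asIdeal.ramificationIdx' P.asIdeal * D (primeUnder F P)) ∧
      (divClass (𝓞 K) D').toMul = ClassGroup.extendedHom (𝓞 F) (𝓞 K) (divClass (𝓞 F) D).toMul := by
  classical
  induction D using Finsupp.induction_linear with
  | zero => exact ⟨0, fun P => by simp, by simp⟩
  | add D₁ D₂ h₁ h₂ =>
    obtain ⟨E₁, hE₁, h₁⟩ := h₁
    obtain ⟨E₂, hE₂, h₂⟩ := h₂
    refine ⟨E₁ + E₂, fun P => ?_, ?_⟩
    · rw [Finsupp.add_apply, Finsupp.add_apply, hE₁, hE₂, mul_add]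
    · rw [(divClass _).map_add, (divClass _).map_add, toMul_add, toMul_add, map_mul, h₁, h₂]
  | single p n =>
    have hmax : p.asIdeal.IsMaximal := p.isMaximal
    let J : (Ideal (𝓞 K))⁰ := ClassGroup.extendedIdeal (𝓞 F) (𝓞 K)
      ⟨p.asIdeal, mem_nonZeroDivisors_of_ne_zero p.ne_bot⟩
    have hJ0 : (J : Ideal (𝓞 K)) ≠ 0 := nonZeroDivisors.coe_ne_zero J
    have hfin : {P : HeightOneSpectrum (𝓞 K) | FractionalIdeal.count K P
        (FractionalIdeal.mk0 K J : FractionalIdeal (𝓞 K)⁰ K) ≠ 0}.Finite :=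
      FractionalIdeal.finite_factors _
    let E : HeightOneSpectrum (𝓞 K) →₀ ℤ := Finsupp.ofSupportFinite _ hfin
    have hE : ∀ P, E P = (primeUnder F P).asIdeal.ramificationIdx' P.asIdeal *
        (Finsupp.single p (1 : ℤ)) (primeUnder F P) := by
      intro P
      have h1 : E P = ((Associates.mk P.asIdeal).count
          (Associates.mk (J : Ideal (𝓞 K))).factors : ℤ) := FractionalIdeal.count_coe K P hJ0
      rw [h1]
      by_cases hP : primeUnder F P = p
      · rw [hP, Finsupp.single_eq_same, mul_one, Nat.cast_inj,
          Ideal.IsDedekindDomain.ramificationIdx'_eq_normalizedFactors_count hJ0 P.isPrime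
            P.ne_bot]
        exact Ideal.count_associates_factors_eq hJ0 P.isPrime P.ne_bot
      · rw [Finsupp.single_eq_of_ne hP, mul_zero, Nat.cast_eq_zero]
        by_contra hne
        rw [← ne_eq, Associates.count_ne_zero_iff_dvd hJ0 P.irreducible] at hne
        refine hP ((liesOver_iff_primeUnder_eq P p).1 ?_)
        exact (Ideal.liesOver_iff_dvd_map P.isPrime.ne_top).2 hne
    refine ⟨n • E, fun P => ?_, ?_⟩
    · rw [Finsupp.smul_apply, hE, ← mul_one n, ← smul_eq_mul n 1, ← Finsupp.smul_single,
        Finsupp.smul_apply, smul_eq_mul, smul_eq_mul]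
      ring
    · rw [map_zsmul, divClass_single, toMul_zsmul, toMul_zsmul, map_zpow, toMul_ofMul,
        ClassGroup.extendedHom_mk0, divClass_eq_mk K E (FractionalIdeal.mk0 K J) fun P => rfl,
        toMul_ofMul, ClassGroup.mk_mk0]

theorem ramificationIdx'_eq_one_of_notMem_above {S : Set (Place F)} (hur : UnramifiedOutside K S)
    {P : HeightOneSpectrum (𝓞 K)} (hP : Sum.inl (primeUnder F P) ∉ S) :
    (primeUnder F P).asIdeal.ramificationIdx' P.asIdeal = 1 := by
  have h : Algebra.IsUnramifiedAt (𝓞 F) P.asIdeal := hur (Sum.inl P) (mt inl_mem_above_iff.1 hP)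
  rw [Ideal.ramificationIdx'_eq_ramificationIdx _ _ (primeUnder F P).ne_bot]
  exact Ideal.ramificationIdx_eq_one_of_isUnramifiedAt

/-- A divisor of `F` capitulates in `K` if and only if, outside `S`, it becomes the divisor of an
element of `K`. -/
theorem capitulationMap_mk_divClass_eq_one_iff {S : Set (Place F)} (hur : UnramifiedOutside K S)
    (D : HeightOneSpectrum (𝓞 F) →₀ ℤ) :
    capitulationMap F K S (QuotientGroup.mk (divClass (𝓞 F) D).toMul) = 1 ↔
      ∃ x : Kˣ, ∀ P : HeightOneSpectrum (𝓞 K), Sum.inl (primeUnder F P) ∉ S →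
        ord K P (Additive.ofMul x) = D (primeUnder F P) := by
  obtain ⟨D', hD', h⟩ := exists_divClass_eq_extendedHom (K := K) D
  have h1 : capitulationMap F K S (QuotientGroup.mk (divClass (𝓞 F) D).toMul) =
      QuotientGroup.mk (divClass (𝓞 K) D').toMul := by
    rw [h]
    rfl
  rw [h1, mk_divClass_eq_one_iff]
  refine exists_congr fun x => forall_congr' fun P => ?_
  rw [inl_mem_above_iff]
  refine forall_congr' fun hP => ?_
  rw [hD', ramificationIdx'_eq_one_of_notMem_above hur hP, Nat.cast_one, one_mul]

end Classes

section TateIndices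

set_option linter.unusedSectionVars false

variable {F K : Type*} [Field F] [NumberField F] [Field K] [NumberField K] [Algebra F K]
  [IsGalois F K]

/-! ### The degree zero index of the `S`-units -/

/-- An element fixed by a generator of the Galois group comes from the base field. -/
theorem exists_map_algebraMap_eq {σ : Gal(K/F)} (hσ : ∀ g, g ∈ Subgroup.zpowers σ) {x : Kˣ}
    (hx : σ • x = x) : ∃ y : Fˣ, Units.map (algebraMap F K).toMonoidHom y = x := by
  have h1 : ∀ g : Gal(K/F), g • x = x := fun g =>
    (Subgroup.zpowers_le (H := MulAction.stabilizer Gal(K/F) x)).2 hx (hσ g)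
  obtain ⟨y, hy⟩ := (IsGalois.mem_range_algebraMap_iff_fixed (x : K)).2
    fun g => congrArg Units.val (h1 g)
  have hy0 : y ≠ 0 := by
    rintro rfl
    exact x.ne_zero (by rw [← hy, map_zero])
  exact ⟨Units.mk0 y hy0, Units.ext hy⟩

theorem map_algebraMap_mem_SUnits_iff {S : Set (Place F)} {y : Fˣ} :
    Units.map (algebraMap F K).toMonoidHom y ∈ SUnits K (above K S) ↔ y ∈ SUnits F S := by
  rw [mem_SUnits_iff, mem_SUnits_iff]
  constructor
  · intro h p hp
    obtain ⟨P, rfl⟩ := exists_primeUnder_eq (K := K) p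
    have := h P (mt inl_mem_above_iff.1 hp)
    rw [ord_algebraMap] at this
    exact (mul_eq_zero.1 this).resolve_left (ramificationIdx'_primeUnder_ne_zero P)
  · intro h P hP
    rw [ord_algebraMap, h _ (mt inl_mem_above_iff.2 hP), mul_zero]

/-- The degree zero index of the `S`-units is the norm index: the invariants are the `S`-units of
the base field. -/
theorem relIndex_sUnitsNorm_range (S : Set (Place F)) {σ : Gal(K/F)}
    (hσ : ∀ g, g ∈ Subgroup.zpowers σ) :
    (sUnitsNorm F K S).range.relIndex (sUnitsDiff S σ).ker =
      (normSUnits (K := K) S).range.index := by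
  let j : Additive (SUnits F S) →+ Additive (SUnits K (above K S)) :=
    { toFun := fun y => Additive.ofMul ⟨Units.map (algebraMap F K).toMonoidHom (y.toMul : Fˣ),
        map_algebraMap_mem_SUnits_iff.2 y.toMul.2⟩
      map_zero' := congrArg Additive.ofMul (Subtype.ext (map_one _))
      map_add' := fun y z => congrArg Additive.ofMul (Subtype.ext (map_mul _ _ _)) }
  have hj : Function.Injective j := by
    intro y z h
    have h1 : Units.map (algebraMap F K).toMonoidHom (y.toMul : Fˣ) =
        Units.map (algebraMap F K).toMonoidHom (z.toMul : Fˣ) :=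
      congrArg (fun u : Additive (SUnits K (above K S)) => (u.toMul : Kˣ)) h
    exact Additive.toMul.injective (Subtype.ext
      (Units.map_injective (algebraMap F K).injective h1))
  let NF : Additive (SUnits K (above K S)) →+ Additive (SUnits F S) := (normSUnits S).toAdditive
  have hN : sUnitsNorm F K S = j.comp NF := by
    refine AddMonoidHom.ext fun x => ?_
    refine Additive.toMul.injective (Subtype.ext (Units.ext ?_))
    rw [coe_sUnitsNorm]
    exact (Algebra.norm_eq_prod_automorphisms F _).symm
  have hT : (sUnitsDiff S σ).ker = j.range := by
    ext x
    rw [AddMonoidHom.mem_ker, sUnitsDiff_apply, sub_eq_zero]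
    constructor
    · intro h
      obtain ⟨y, hy⟩ := exists_map_algebraMap_eq hσ (x := (x.toMul : Kˣ))
        (congrArg (fun u : Additive (SUnits K (above K S)) => (u.toMul : Kˣ)) h)
      have hyS : y ∈ SUnits F S := by
        rw [← map_algebraMap_mem_SUnits_iff (K := K), hy]
        exact x.toMul.2
      exact ⟨Additive.ofMul ⟨y, hyS⟩, congrArg Additive.ofMul (Subtype.ext hy)⟩
    · rintro ⟨y, rfl⟩
      exact congrArg Additive.ofMul (Subtype.ext (Units.ext (σ.commutes _)))
  rw [hN, hT, AddMonoidHom.range_comp, AddMonoidHom.range_eq_map j,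
    AddSubgroup.relIndex_map_map_of_injective _ _ hj, AddSubgroup.relIndex_top_right]
  rfl

/-! ### The degree one index of the `S`-units -/

/-- Pairs of an element `x` of `Kˣ` and a divisor `D` of `F` such that, at the primes outside `S`,
the order of `x` is given by `D`. Sending `(x, D)` to `σ x / x` describes the kernel of the norm on
`S`-units, and sending it to the class of `D` describes the kernel of the capitulation map. -/
def capitulationPairs (K : Type*) [Field K] [NumberField K] [Algebra F K] (S : Set (Place F)) :
    AddSubgroup (Additive Kˣ × (HeightOneSpectrum (𝓞 F) →₀ ℤ)) where
  carrier := {a | ∀ P : HeightOneSpectrum (𝓞 K), Sum.inl (primeUnder F P) ∉ S →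
    ord K P a.1 = a.2 (primeUnder F P)}
  zero_mem' _ _ := by simp
  add_mem' ha hb P hP := by simp [ha P hP, hb P hP]
  neg_mem' ha P hP := by simp [ha P hP]

variable (S : Set (Place F))

/-- The map `(x, D) ↦ σ x / x`. -/
def capitulationPairsDiff (σ : Gal(K/F)) :
    capitulationPairs K S →+ Additive (SUnits K (above K S)) where
  toFun a := Additive.ofMul ⟨σ • a.1.1.toMul / a.1.1.toMul, by
    rw [mem_SUnits_iff]
    intro P hP
    have hP' := mt inl_mem_above_iff.2 hP
    have h1 := a.2 P hP'
    have h2 := a.2 (σ⁻¹ • P) (by rwa [primeUnder_smul])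
    rw [ofMul_div, map_sub, ord_smul', ofMul_toMul, h1, h2, primeUnder_smul, sub_self]⟩
  map_zero' := by
    refine congrArg Additive.ofMul (Subtype.ext ?_)
    change σ • (1 : Kˣ) / 1 = 1
    rw [smul_one, div_one]
  map_add' a b := by
    refine congrArg Additive.ofMul (Subtype.ext ?_)
    change σ • (a.1.1.toMul * b.1.1.toMul) / (a.1.1.toMul * b.1.1.toMul) = _
    rw [smul_mul', mul_div_mul_comm]
    rfl

variable (K) in
/-- The map `(x, D) ↦ [D]`. -/
def capitulationPairsClass : capitulationPairs K S →+ Additive (SClassGroup F S) where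
  toFun a := Additive.ofMul (QuotientGroup.mk (divClass (𝓞 F) a.1.2).toMul)
  map_zero' := by simp
  map_add' a b := by simp

/-- By Hilbert's theorem 90 every `S`-unit of norm one is `σ x / x` for some `x`; the orders of `x`
outside `S` then only depend on the prime below, so that they define a divisor of `F`. -/
theorem range_capitulationPairsDiff {σ : Gal(K/F)} (hσ : ∀ g, g ∈ Subgroup.zpowers σ) :
    (capitulationPairsDiff S σ).range = (sUnitsNorm F K S).ker := by
  ext u
  rw [AddMonoidHom.mem_ker]
  have hu : sUnitsNorm F K S u = 0 ↔ ∏ g : Gal(K/F), g ((u.toMul : Kˣ) : K) = 1 := by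
    rw [← coe_sUnitsNorm S u]
    constructor
    · intro h
      rw [h]
      rfl
    · intro h
      exact Additive.toMul.injective (Subtype.ext (Units.ext h))
  rw [hu]
  constructor
  · rintro ⟨⟨⟨x, D⟩, h⟩, rfl⟩
    have h1 : ∀ g : Gal(K/F), g ((((capitulationPairsDiff S σ ⟨⟨x, D⟩, h⟩).toMul : Kˣ) : K)) =
        (g * σ) (x.toMul : K) / g (x.toMul : K) := by
      intro g
      rw [AlgEquiv.mul_apply, ← map_div₀]
      congr 1
      exact Units.val_div_eq_div_val _ _
    rw [Finset.prod_congr rfl fun g _ => h1 g, Finset.prod_div_distrib]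
    have h2 : ∏ g : Gal(K/F), (g * σ) (x.toMul : K) = ∏ g : Gal(K/F), g (x.toMul : K) :=
      Fintype.prod_equiv (Equiv.mulRight σ) _ _ fun _ => rfl
    rw [h2, div_self]
    exact Finset.prod_ne_zero_iff.2 fun g _ => by simp
  · intro h
    obtain ⟨x, hx⟩ := exists_smul_div_eq_of_prod_eq_one hσ _ h
    -- outside `S` the orders of `x` are constant along the fibres of `primeUnder`
    have hinv : ∀ (g : Gal(K/F)) (P : HeightOneSpectrum (𝓞 K)), Sum.inl (primeUnder F P) ∉ S →
        ord K (g • P) (Additive.ofMul x) = ord K P (Additive.ofMul x) := by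
      let H : Subgroup Gal(K/F) :=
        { carrier := {g | ∀ P : HeightOneSpectrum (𝓞 K), Sum.inl (primeUnder F P) ∉ S →
            ord K (g • P) (Additive.ofMul x) = ord K P (Additive.ofMul x)}
          one_mem' := fun P _ => by rw [one_smul]
          mul_mem' := fun {a b} ha hb P hP => by
            rw [mul_smul, ha _ (by rwa [primeUnder_smul]), hb P hP]
          inv_mem' := fun {a} ha P hP => by
            rw [← ha (a⁻¹ • P) (by rwa [primeUnder_smul]), smul_inv_smul] }
      have hH : σ⁻¹ ∈ H := by
        intro P hP
        have h1 := mem_SUnits_iff.1 u.toMul.2 P (mt inl_mem_above_iff.1 hP)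
        rw [← hx, ofMul_div, map_sub, ord_smul', sub_eq_zero] at h1
        exact h1
      have hle : Subgroup.zpowers σ ≤ H := Subgroup.zpowers_le.2 (by simpa using H.inv_mem hH)
      exact fun g => hle (hσ g)
    choose Q hQ using exists_primeUnder_eq (F := F) (K := K)
    have hfin : {p : HeightOneSpectrum (𝓞 F) | ord K (Q p) (Additive.ofMul x) ≠ 0}.Finite :=
      (finite_support_ord (Additive.ofMul x)).preimage
        (Function.LeftInverse.injective hQ).injOn
    refine ⟨⟨⟨Additive.ofMul x, Finsupp.ofSupportFinite _ hfin⟩, fun P hP => ?_⟩, ?_⟩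
    · obtain ⟨g, hg⟩ := exists_smul_eq_of_primeUnder_eq (hQ (primeUnder F P))
      rw [← hg, hinv g _ (by rwa [hQ]), hg]
      rfl
    · exact Additive.toMul.injective (Subtype.ext hx)

/-- The classes of the divisors in capitulation pairs form the capitulation kernel: as the
ramification indices outside `S` are one, the second element of a pair becomes, outside `S`, the
divisor of the first. -/
theorem range_capitulationPairsClass (hur : UnramifiedOutside K S) :
    (capitulationPairsClass K S).range = Subgroup.toAddSubgroup (capitulationMap F K S).ker := by
  ext c
  constructor
  · rintro ⟨⟨⟨x, D⟩, h⟩, rfl⟩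
    exact (capitulationMap_mk_divClass_eq_one_iff hur D).2 ⟨x.toMul, h⟩
  · intro hc
    obtain ⟨c', hc'⟩ := QuotientGroup.mk_surjective c.toMul
    obtain ⟨D, hD⟩ := divClass_surjective (Additive.ofMul c')
    have h1 : capitulationMap F K S (QuotientGroup.mk (divClass (𝓞 F) D).toMul) = 1 := by
      rw [hD, toMul_ofMul, hc']
      exact hc
    obtain ⟨x, hx⟩ := (capitulationMap_mk_divClass_eq_one_iff hur D).1 h1
    refine ⟨⟨⟨Additive.ofMul x, D⟩, hx⟩, ?_⟩
    refine Additive.toMul.injective ?_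
    rw [← hc']
    exact congrArg (fun d => (QuotientGroup.mk (Additive.toMul d) : SClassGroup F S)) hD

/-- Both conditions on a pair `(x, D)` say that `x` is the product of an element of `Fˣ` and an
`S`-unit. -/
theorem comap_capitulationPairsDiff (hur : UnramifiedOutside K S) {σ : Gal(K/F)}
    (hσ : ∀ g, g ∈ Subgroup.zpowers σ) :
    (sUnitsDiff S σ).range.comap (capitulationPairsDiff S σ) = (capitulationPairsClass K S).ker := by
  ext ⟨⟨x, D⟩, h⟩
  have h1 : (⟨⟨x, D⟩, h⟩ : capitulationPairs K S) ∈ (capitulationPairsClass K S).ker ↔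
      ∃ y : Fˣ, ∀ p, Sum.inl p ∉ S → ord F p (Additive.ofMul y) = D p :=
    mk_divClass_eq_one_iff S D
  have hy : ∀ (y : Fˣ) (P : HeightOneSpectrum (𝓞 K)), Sum.inl (primeUnder F P) ∉ S →
      ord K P (Additive.ofMul (Units.map (algebraMap F K).toMonoidHom y)) =
        ord F (primeUnder F P) (Additive.ofMul y) := by
    intro y P hP
    rw [ord_algebraMap, ramificationIdx'_eq_one_of_notMem_above hur hP, Nat.cast_one, one_mul]
  rw [h1, AddSubgroup.mem_comap]
  constructor
  · rintro ⟨u, hu⟩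
    have h2 : σ • (u.toMul : Kˣ) / u.toMul = σ • x.toMul / x.toMul :=
      congrArg (fun u : Additive (SUnits K (above K S)) => (u.toMul : Kˣ)) hu
    obtain ⟨y, hyx⟩ := exists_map_algebraMap_eq hσ (x := x.toMul / (u.toMul : Kˣ)) (by
      rw [smul_div', div_eq_div_iff_mul_eq_mul, mul_comm, mul_comm (x.toMul)]
      rw [div_eq_div_iff_mul_eq_mul] at h2
      rw [mul_comm, ← h2])
    refine ⟨y, fun p hp => ?_⟩
    obtain ⟨P, rfl⟩ := exists_primeUnder_eq (K := K) p
    have h3 := mem_SUnits_iff.1 u.toMul.2 P (mt inl_mem_above_iff.1 hp)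
    rw [← hy y P hp, hyx, ofMul_div, map_sub, h3, sub_zero]
    exact h P hp
  · rintro ⟨y, hyD⟩
    have hu : x.toMul / Units.map (algebraMap F K).toMonoidHom y ∈ SUnits K (above K S) := by
      rw [mem_SUnits_iff]
      intro P hP
      have hP' := mt inl_mem_above_iff.2 hP
      rw [ofMul_div, map_sub, hy y P hP', hyD _ hP', sub_eq_zero]
      exact h P hP'
    refine ⟨Additive.ofMul ⟨_, hu⟩, Additive.toMul.injective (Subtype.ext ?_)⟩
    change σ • (x.toMul / Units.map (algebraMap F K).toMonoidHom y) /
      (x.toMul / Units.map (algebraMap F K).toMonoidHom y) = σ • x.toMul / x.toMul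
    have h2 : σ • Units.map (algebraMap F K).toMonoidHom y =
        Units.map (algebraMap F K).toMonoidHom y := Units.ext (σ.commutes _)
    rw [smul_div', h2, div_div_div_cancel_right]

/-- The degree one index of the `S`-units is the order of the capitulation kernel. -/
theorem relIndex_sUnitsDiff_range (hur : UnramifiedOutside K S) {σ : Gal(K/F)}
    (hσ : ∀ g, g ∈ Subgroup.zpowers σ) :
    (sUnitsDiff S σ).range.relIndex (sUnitsNorm F K S).ker =
      Nat.card (capitulationMap F K S).ker := by
  rw [← range_capitulationPairsDiff S hσ, ← AddSubgroup.index_comap,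
    comap_capitulationPairsDiff S hur hσ, AddSubgroup.index_ker,
    range_capitulationPairsClass S hur]
  rfl

end TateIndices

/-! ### A permutation sublattice of the `S`-units -/

/-- A left null vector of a matrix with negative off-diagonal entries and vanishing row sums has
all its entries of the same sign, hence vanishes if its entries sum to zero. -/
theorem eq_zero_of_sum_mul_eq_zero {W : Type*} [Fintype W] (A : W → W → ℝ)
    (hA : ∀ w w', w' ≠ w → A w w' < 0) (hrow : ∀ w, ∑ w', A w w' = 0) (a : W → ℝ)
    (ha : ∀ w', ∑ w, a w * A w w' = 0) (hsum : ∑ w, a w = 0) : a = 0 := by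
  classical
  -- it suffices to show that no entry is positive
  by_cases hne : ∃ w, 0 < a w
  · obtain ⟨w₀, hw₀⟩ := hne
    by_cases hall : ∀ w, 0 < a w
    · exact absurd hsum (Finset.sum_pos (fun w _ => hall w) ⟨w₀, Finset.mem_univ _⟩).ne'
    · exfalso
      push Not at hall
      obtain ⟨w₁, hw₁⟩ := hall
      -- sum the columns indexed by the positive entries
      let c : W → ℝ := fun w => ∑ w' with 0 < a w', A w w'
      have h0 : ∑ w, a w * c w = 0 := by
        simp only [c, Finset.mul_sum]
        rw [Finset.sum_comm]
        exact Finset.sum_eq_zero fun w' _ => ha w'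
      have hpos : ∀ w, 0 < a w → 0 < c w := by
        intro w hw
        have h1 := hrow w
        rw [← Finset.sum_filter_add_sum_filter_not _ (fun w' => 0 < a w')] at h1
        have h2 : ∑ w' with ¬ 0 < a w', A w w' < 0 := by
          refine Finset.sum_neg (fun w' hw' => hA w w' ?_) ⟨w₁, by simpa using hw₁⟩
          rintro rfl
          exact (Finset.mem_filter.1 hw').2 hw
        simp only [c]
        linarith
      have hneg : ∀ w, ¬ 0 < a w → c w ≤ 0 := by
        intro w hw
        refine Finset.sum_nonpos fun w' hw' => (hA w w' ?_).le
        rintro rfl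
        exact hw (Finset.mem_filter.1 hw').2
      refine (Finset.sum_pos' (s := Finset.univ) (f := fun w => a w * c w) (fun w _ => ?_)
        ⟨w₀, Finset.mem_univ _, mul_pos hw₀ (hpos _ hw₀)⟩).ne' h0
      by_cases hw : 0 < a w
      · exact (mul_pos hw (hpos w hw)).le
      · exact mul_nonneg_of_nonpos_of_nonpos (not_lt.1 hw) (hneg w hw)
  · push Not at hne
    have h1 := (Finset.sum_eq_zero_iff_of_nonpos fun w _ => hne w).1 hsum
    exact funext fun w => h1 w (Finset.mem_univ w)

theorem index_ne_zero_of_forall_zsmul_mem {B : Type*} [AddCommGroup B] [Module.Finite ℤ B]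
    (D : AddSubgroup B) (hD : ∀ b, ∃ k : ℤ, k ≠ 0 ∧ k • b ∈ D) : D.index ≠ 0 := by
  rw [AddSubgroup.index_ne_zero_iff_finite]
  have : Module.Finite ℤ (B ⧸ D) :=
    Module.Finite.of_surjective (QuotientAddGroup.mk' D).toIntLinearMap
      (QuotientAddGroup.mk'_surjective D)
  refine Module.finite_of_fg_torsion _ ?_
  intro x
  obtain ⟨b, rfl⟩ := QuotientAddGroup.mk_surjective x
  obtain ⟨k, hk, hb⟩ := hD b
  exact ⟨⟨k, mem_nonZeroDivisors_of_ne_zero hk⟩, (QuotientAddGroup.eq_zero_iff _).2 hb⟩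

section Units

variable {K : Type*} [Field K] [NumberField K]

theorem ord_map_algebraMap_unit (P : HeightOneSpectrum (𝓞 K)) (v : (𝓞 K)ˣ) :
    ord K P (Additive.ofMul (Units.map (algebraMap (𝓞 K) K).toMonoidHom v)) = 0 := by
  rw [← valuation_eq_one_iff_ord_eq_zero]
  have h1 := P.valuation_le_one (K := K) (v : 𝓞 K)
  have h2 := P.valuation_le_one (K := K) ((v⁻¹ : (𝓞 K)ˣ) : 𝓞 K)
  refine le_antisymm h1 ?_
  have h3 : P.valuation K (algebraMap (𝓞 K) K v) *
      P.valuation K (algebraMap (𝓞 K) K (v⁻¹ : (𝓞 K)ˣ)) = 1 := by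
    rw [← map_mul, ← map_mul, Units.mul_inv, map_one, map_one]
  rw [← h3]
  exact mul_le_of_le_one_right' h2

theorem exists_unit_of_ord_eq_zero {x : Kˣ}
    (hx : ∀ P : HeightOneSpectrum (𝓞 K), ord K P (Additive.ofMul x) = 0) :
    ∃ v : (𝓞 K)ˣ, Units.map (algebraMap (𝓞 K) K).toMonoidHom v = x := by
  obtain ⟨a, ha⟩ := HeightOneSpectrum.mem_integers_of_valuation_le_one (R := 𝓞 K) K (x : K)
    fun P => ((valuation_eq_one_iff_ord_eq_zero P x).2 (hx P)).le
  obtain ⟨b, hb⟩ := HeightOneSpectrum.mem_integers_of_valuation_le_one (R := 𝓞 K) K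
    ((x⁻¹ : Kˣ) : K) fun P => ((valuation_eq_one_iff_ord_eq_zero P x⁻¹).2 (by
      rw [ofMul_inv, map_neg, hx, neg_zero])).le
  have hab : a * b = 1 := by
    apply FaithfulSMul.algebraMap_injective (𝓞 K) K
    rw [map_mul, ha, hb, Units.mul_inv, map_one]
  exact ⟨⟨a, b, hab, by rw [mul_comm, hab]⟩, Units.ext ha⟩

/-- The logarithm of an infinite absolute value, as a homomorphism. -/
def logAbs (w : InfinitePlace K) : Additive Kˣ →+ ℝ where
  toFun x := Real.log (w (x.toMul : K))
  map_zero' := by simp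
  map_add' x y := by
    rw [toMul_add, Units.val_mul, map_mul, Real.log_mul] <;> simp

theorem finrank_units_prod :
    Module.finrank ℤ (Additive (𝓞 K)ˣ × ℤ) = Fintype.card (InfinitePlace K) := by
  have h := Submodule.finrank_quotient_add_finrank
    (LinearMap.ker (LinearMap.snd ℤ (Additive (𝓞 K)ˣ) ℤ))
  rw [((LinearMap.snd ℤ (Additive (𝓞 K)ˣ) ℤ).quotKerEquivOfSurjective
    LinearMap.snd_surjective).finrank_eq, LinearMap.ker_snd,
    LinearMap.finrank_range_of_inj LinearMap.inl_injective, Units.finrank_eq,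
    Module.finrank_self, Units.rank] at h
  rw [← h]
  have : 0 < Fintype.card (InfinitePlace K) := Fintype.card_pos
  omega

variable (η : InfinitePlace K → (𝓞 K)ˣ)
  (hη : ∀ w w' : InfinitePlace K, w' ≠ w → Real.log (w' (algebraMap (𝓞 K) K (η w))) < 0)

include hη

/-- The product formula makes the rows of the matrix of weighted logarithms of the `η w` sum to
zero, so the only relation of total exponent zero between the `η w` is the trivial one. -/
theorem eq_zero_of_sum_zsmul_units_eq_zero (a : InfinitePlace K → ℤ)
    (h : ∑ w, a w • Additive.ofMul (η w) = 0) (hsum : ∑ w, a w = 0) : a = 0 := by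
  have key := eq_zero_of_sum_mul_eq_zero
    (fun w w' : InfinitePlace K => w'.mult * Real.log (w' (algebraMap (𝓞 K) K (η w))))
    (fun w w' hw => mul_neg_of_pos_of_neg (by exact_mod_cast w'.mult_pos) (hη w w' hw))
    (fun w => Units.sum_mult_mul_log (η w)) (fun w => (a w : ℝ)) (fun w' => ?_)
    (by exact_mod_cast hsum)
  · funext w
    simpa using congrFun key w
  · have h1 := congrArg ((logAbs w').comp
      (Units.map (algebraMap (𝓞 K) K).toMonoidHom).toAdditive) h
    rw [map_sum, map_zero] at h1
    simp only [map_zsmul, zsmul_eq_mul] at h1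
    have h2 : ∑ w, (a w : ℝ) * Real.log (w' (algebraMap (𝓞 K) K (η w))) = 0 := h1
    calc _ = ∑ w, (w'.mult : ℝ) * ((a w : ℝ) * Real.log (w' (algebraMap (𝓞 K) K (η w)))) :=
          Finset.sum_congr rfl fun w _ => by ring
      _ = 0 := by rw [← Finset.mul_sum, h2, mul_zero]

/-- By Dirichlet's unit theorem the pairs `(η w, 1)` span a subgroup of finite index. -/
theorem exists_zsmul_eq_sum_units (v : (𝓞 K)ˣ) (k : ℤ) :
    ∃ c : ℤ, c ≠ 0 ∧ ∃ a : InfinitePlace K → ℤ,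
      c • Additive.ofMul v = ∑ w, a w • Additive.ofMul (η w) ∧ c * k = ∑ w, a w := by
  classical
  let ψ : (InfinitePlace K → ℤ) →ₗ[ℤ] (Additive (𝓞 K)ˣ × ℤ) :=
    Fintype.linearCombination ℤ (fun w => (Additive.ofMul (η w), (1 : ℤ)))
  have hψ : ∀ a, ψ a = (∑ w, a w • Additive.ofMul (η w), ∑ w, a w) := by
    intro a
    rw [Fintype.linearCombination_apply]
    ext
    · simp [Prod.fst_sum]
    · simp [Prod.snd_sum]
  have hinj : Function.Injective ψ := by
    rw [injective_iff_map_eq_zero]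
    intro a ha
    rw [hψ, Prod.mk_eq_zero] at ha
    exact eq_zero_of_sum_zsmul_units_eq_zero η hη a ha.1 ha.2
  have h1 := Submodule.finrank_quotient_add_finrank (LinearMap.range ψ)
  rw [LinearMap.finrank_range_of_inj hinj, finrank_units_prod, Module.finrank_fintype_fun_eq_card]
    at h1
  have htor := Module.finrank_eq_zero_iff_isTorsion.1 (Nat.add_eq_right.1 h1)
  obtain ⟨c, hc⟩ := @htor (Submodule.Quotient.mk (Additive.ofMul v, k))
  have hc' : (c : ℤ) • (Additive.ofMul v, k) ∈ LinearMap.range ψ :=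
    (Submodule.Quotient.mk_eq_zero _).1 hc
  obtain ⟨a, ha⟩ := hc'
  rw [hψ] at ha
  exact ⟨c, nonZeroDivisors.coe_ne_zero c, a, (congrArg Prod.fst ha).symm,
    (congrArg Prod.snd ha).symm⟩

end Units

section Comparison

set_option linter.unusedSectionVars false

variable {F K : Type*} [Field F] [NumberField F] [Field K] [NumberField K] [Algebra F K]
  [IsGalois F K]

/-- The inclusion of the `S`-units in `Kˣ`, written additively. -/
def sUnitsVal (K : Type*) [Field K] [NumberField K] [Algebra F K] (S : Set (Place F)) :
    Additive (SUnits K (above K S)) →+ Additive Kˣ :=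
  (SUnits K (above K S)).subtype.toAdditive

theorem sUnitsVal_injective (S : Set (Place F)) : Function.Injective (sUnitsVal K S) :=
  fun _ _ h => Additive.toMul.injective (Subtype.ext (congrArg Additive.toMul h))

theorem ord_sUnitsVal_eq_zero {S : Set (Place F)} (u : Additive (SUnits K (above K S)))
    {P : HeightOneSpectrum (𝓞 K)} (hP : Sum.inl P ∉ above K S) : ord K P (sUnitsVal K S u) = 0 :=
  mem_SUnits_iff.1 u.toMul.2 P hP

theorem ord_sUnitsAct {S : Set (Place F)} (g : Gal(K/F)) (u : Additive (SUnits K (above K S)))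
    (P : HeightOneSpectrum (𝓞 K)) :
    ord K P (sUnitsVal K S (sUnitsAct S g u)) = ord K (g⁻¹ • P) (sUnitsVal K S u) :=
  ord_smul' g P _

theorem logAbs_sUnitsAct {S : Set (Place F)} (g : Gal(K/F)) (u : Additive (SUnits K (above K S)))
    (w : InfinitePlace K) :
    logAbs w (sUnitsVal K S (sUnitsAct S g u)) = logAbs (g⁻¹ • w) (sUnitsVal K S u) := rfl

/-- The group of `S`-units is finitely generated: the orders at the primes in `S` have as their
kernel the units of the ring of integers. -/
theorem finite_sUnits {S : Set (Place F)} (hS : S.Finite) :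
    Module.Finite ℤ (Additive (SUnits K (above K S))) := by
  have hX := (finite_above (K := K) S hS).to_subtype
  let T : Type _ := {P : HeightOneSpectrum (𝓞 K) // Sum.inl P ∈ above K S}
  have : Finite T := Finite.of_injective (fun P : T => (⟨Sum.inl P.1, P.2⟩ : above K S))
    fun P Q h => Subtype.ext (Sum.inl_injective (congrArg Subtype.val h))
  let f : Additive (SUnits K (above K S)) →ₗ[ℤ] (T → ℤ) :=
    (AddMonoidHom.pi fun P : T => (ord K P.1).comp (sUnitsVal K S)).toIntLinearMap
  let j : Additive (𝓞 K)ˣ →ₗ[ℤ] Additive (SUnits K (above K S)) :=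
    AddMonoidHom.toIntLinearMap
      { toFun := fun v => Additive.ofMul ⟨Units.map (algebraMap (𝓞 K) K).toMonoidHom v.toMul,
          mem_SUnits_iff.2 fun P _ => ord_map_algebraMap_unit P _⟩
        map_zero' := congrArg Additive.ofMul (Subtype.ext (map_one _))
        map_add' := fun y z => congrArg Additive.ofMul (Subtype.ext (map_mul _ _ _)) }
  have hker : LinearMap.ker f ≤ LinearMap.range j := by
    intro u hu
    obtain ⟨v, hv⟩ := exists_unit_of_ord_eq_zero (x := (u.toMul : Kˣ)) fun P => by
      by_cases hP : Sum.inl P ∈ above K S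
      · exact congrFun hu ⟨P, hP⟩
      · exact ord_sUnitsVal_eq_zero u hP
    exact ⟨Additive.ofMul v, Additive.toMul.injective (Subtype.ext hv)⟩
  refine ⟨Submodule.fg_of_fg_map_of_fg_inf_ker f (IsNoetherian.noetherian _) ?_⟩
  rw [top_inf_eq]
  have : IsNoetherian ℤ (LinearMap.range j) :=
    isNoetherian_of_surjective _ (LinearMap.range_rangeRestrict j)
  exact isNoetherian_submodule.1 this _ hker

end Comparison

section Lattice

set_option linter.unusedSectionVars false

variable {F K : Type*} [Field F] [NumberField F] [Field K] [NumberField K] [Algebra F K]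
  [IsGalois F K]

/-- A Galois-equivariant family of `S`-units indexed by the places above `S`: up to a common
exponent the finite places give generators of the corresponding primes, and the infinite places
give units which are small at all other infinite places. -/
theorem exists_equivariant_sUnits (S : Set (Place F)) :
    ∃ (y : above K S → Additive (SUnits K (above K S))) (m : ℤ), m ≠ 0 ∧
      (∀ (g : Gal(K/F)) x, sUnitsAct S g (y x) = y (g • x)) ∧
      (∀ P hP, ord K P (sUnitsVal K S (y ⟨Sum.inl P, hP⟩)) = m) ∧
      (∀ P hP Q, Q ≠ P → ord K Q (sUnitsVal K S (y ⟨Sum.inl P, hP⟩)) = 0) ∧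
      (∀ w hw (Q : HeightOneSpectrum (𝓞 K)), ord K Q (sUnitsVal K S (y ⟨Sum.inr w, hw⟩)) = 0) ∧
      (∀ w hw w', w' ≠ w → logAbs w' (sUnitsVal K S (y ⟨Sum.inr w, hw⟩)) < 0) := by
  classical
  let h : ℤ := Nat.card (ClassGroup (𝓞 K))
  have hh : 0 < h := Nat.cast_pos.2 Nat.card_pos
  -- the finite places: a generator of the `h`-th power, with `h` the class number
  have hfin : ∀ P : HeightOneSpectrum (𝓞 K), Sum.inl P ∈ above K S →
      ∃ u : Additive (SUnits K (above K S)), ∀ Q : HeightOneSpectrum (𝓞 K),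
        ord K Q (sUnitsVal K S u) = Finsupp.single P h Q := by
    intro P hP
    have h1 : divClass (𝓞 K) (Finsupp.single P h) = 0 := by
      rw [divClass_single, natCast_zsmul]
      rw [← ofMul_pow, pow_card_eq_one', ofMul_one]
    obtain ⟨x, hx⟩ := (divClass_eq_zero_iff K _).1 h1
    refine ⟨Additive.ofMul ⟨x, mem_SUnits_iff.2 fun Q hQ => ?_⟩, hx⟩
    rw [hx, Finsupp.single_eq_of_ne]
    rintro rfl
    exact hQ hP
  have hinf : ∀ w : InfinitePlace K,
      ∃ u : Additive (SUnits K (above K S)),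
        (∀ Q : HeightOneSpectrum (𝓞 K), ord K Q (sUnitsVal K S u) = 0) ∧
        ∀ w', w' ≠ w → logAbs w' (sUnitsVal K S u) < 0 := by
    intro w
    obtain ⟨v, hv⟩ := Units.dirichletUnitTheorem.exists_unit K w
    exact ⟨Additive.ofMul ⟨Units.map (algebraMap (𝓞 K) K).toMonoidHom v,
      mem_SUnits_iff.2 fun P _ => ord_map_algebraMap_unit P _⟩,
      fun Q => ord_map_algebraMap_unit Q _, hv⟩
  choose uf huf using hfin
  choose ui hui hui' using hinf
  let u : above K S → Additive (SUnits K (above K S)) := fun x =>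
    match x with
    | ⟨Sum.inl P, hP⟩ => uf P hP
    | ⟨Sum.inr w, _⟩ => ui w
  -- averaging over the group makes the family equivariant
  let y : above K S → Additive (SUnits K (above K S)) := fun x =>
    ∑ g : Gal(K/F), sUnitsAct S g⁻¹ (u (g • x))
  have hord : ∀ P hP Q, ord K Q (sUnitsVal K S (y ⟨Sum.inl P, hP⟩)) =
      ∑ g : Gal(K/F), Finsupp.single (g • P) h (g • Q) := by
    intro P hP Q
    simp only [y, map_sum, ord_sUnitsAct, inv_inv]
    exact Finset.sum_congr rfl fun g _ => huf (g • P) _ _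
  refine ⟨y, Nat.card Gal(K/F) * h, ?_, ?_, ?_, ?_, ?_, ?_⟩
  · exact mul_ne_zero (Nat.cast_ne_zero.2 Nat.card_pos.ne') hh.ne'
  · intro g x
    simp only [y, map_sum, ← sUnitsAct_mul]
    refine Fintype.sum_equiv (Equiv.mulRight g⁻¹) _ _ fun k => ?_
    rw [Equiv.coe_mulRight, mul_inv_rev, inv_inv, smul_smul, inv_mul_cancel_right]
  · intro P hP
    rw [hord]
    simp [Nat.card_eq_fintype_card]
  · intro P hP Q hQ
    rw [hord]
    refine Finset.sum_eq_zero fun g _ => Finsupp.single_eq_of_ne ?_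
    exact fun hg => hQ (MulAction.injective g hg)
  · intro w hw Q
    simp only [y, map_sum, ord_sUnitsAct]
    exact Finset.sum_eq_zero fun g _ => hui (g • w) _
  · intro w hw w' hw'
    simp only [y, map_sum, logAbs_sUnitsAct, inv_inv]
    exact Finset.sum_neg (fun g _ => hui' (g • w) _ fun hg => hw' (MulAction.injective g hg))
      ⟨1, Finset.mem_univ _⟩

/-- A function on the places above `S` which vanishes at the finite places has the sum of its
values at the infinite places. -/
theorem sum_above_eq_sum_infinitePlace {S : Set (Place F)} [Fintype (above K S)]
    (hX : ∀ w : InfinitePlace K, Sum.inr w ∈ above K S) {M : Type*} [AddCommGroup M]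
    (q : above K S → M) (hq : ∀ P h, q ⟨Sum.inl P, h⟩ = 0) :
    ∑ x, q x = ∑ w, q ⟨Sum.inr w, hX w⟩ := by
  refine (Finset.sum_of_injOn (fun w => (⟨Sum.inr w, hX w⟩ : above K S)) ?_ ?_ ?_ ?_).symm
  · intro w _ w' _ h
    exact Sum.inr_injective (congrArg Subtype.val h)
  · simp
  · rintro ⟨P | w, hx⟩ - hne
    · exact hq P hx
    · exact (hne ⟨w, by simp, rfl⟩).elim
  · exact fun _ _ => rfl

/-- The `S`-units together with a trivial factor `ℤ` contain the permutation module of the places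
above `S` as a Galois submodule of finite index. -/
theorem exists_permutation_sublattice {S : Set (Place F)} (hS : S.Finite)
    (hinf : ∀ v : InfinitePlace F, Sum.inr v ∈ S) [Fintype (above K S)] (σ : Gal(K/F)) :
    ∃ φ : (above K S → ℤ) →+ Additive (SUnits K (above K S)) × ℤ,
      Function.Injective φ ∧ φ.range.index ≠ 0 ∧
      (∀ f, φ (permDiff _ σ f) = (sUnitsDiff S σ).prodMap (0 : ℤ →+ ℤ) (φ f)) ∧
      (∀ f, φ (permNorm Gal(K/F) _ f) =
        (sUnitsNorm F K S).prodMap (AddMonoidHom.mulLeft (Nat.card Gal(K/F) : ℤ)) (φ f)) := by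
  classical
  obtain ⟨y, m, hm, hact, hP, hPQ, hw, hlog⟩ := exists_equivariant_sUnits (K := K) S
  have hwX : ∀ w : InfinitePlace K, Sum.inr w ∈ above K S := fun w =>
    ⟨Sum.inr (w.comap (algebraMap F K)), hinf _, rfl⟩
  -- the second coordinate of the basis vectors: `1` at infinite and `0` at finite places
  let d : above K S → ℤ := fun x => Sum.elim (fun _ => 0) (fun _ => 1) x.1
  have hd : ∀ (g : Gal(K/F)) x, d (g • x) = d x := by
    rintro g ⟨P | w, hx⟩ <;> rfl
  let φ : (above K S → ℤ) →+ Additive (SUnits K (above K S)) × ℤ :=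
    (Fintype.linearCombination ℤ fun x => (y x, d x)).toAddMonoidHom
  have hφ : ∀ f, φ f = (∑ x, f x • y x, ∑ x, f x * d x) := by
    intro f
    change Fintype.linearCombination ℤ (fun x => (y x, d x)) f = _
    rw [Fintype.linearCombination_apply]
    refine Prod.ext ?_ ?_
    · simp [Prod.fst_sum]
    · simp [Prod.snd_sum]
  -- translating the function translates the image
  have hy : ∀ (g : Gal(K/F)) (f : above K S → ℤ),
      ∑ x, f (g⁻¹ • x) • y x = sUnitsAct S g (∑ x, f x • y x) := by
    intro g f
    rw [map_sum]
    refine (Fintype.sum_equiv (MulAction.toPerm g) _ _ fun x => ?_).symm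
    rw [map_zsmul, hact, MulAction.toPerm_apply, inv_smul_smul]
  have hdf : ∀ (g : Gal(K/F)) (f : above K S → ℤ), ∑ x, f (g • x) * d x = ∑ x, f x * d x := by
    intro g f
    refine Fintype.sum_equiv (MulAction.toPerm g) _ _ fun x => ?_
    rw [MulAction.toPerm_apply, hd]
  -- sums over the places above `S` split into finite and infinite places
  have hordsum : ∀ (f : above K S → ℤ) (P : HeightOneSpectrum (𝓞 K)) (h : Sum.inl P ∈ above K S),
      ord K P (sUnitsVal K S (∑ x, f x • y x)) = f ⟨Sum.inl P, h⟩ * m := by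
    intro f P h
    rw [map_sum, map_sum, Finset.sum_eq_single ⟨Sum.inl P, h⟩]
    · rw [map_zsmul, map_zsmul, hP, smul_eq_mul]
    · rintro ⟨Q | w, hx⟩ - hne
      · rw [map_zsmul, map_zsmul, hPQ, smul_zero]
        rintro rfl
        exact hne rfl
      · rw [map_zsmul, map_zsmul, hw, smul_zero]
    · simp
  have hη : ∀ w : InfinitePlace K, ∃ v : (𝓞 K)ˣ,
      Units.map (algebraMap (𝓞 K) K).toMonoidHom v = ((y ⟨Sum.inr w, hwX w⟩).toMul : Kˣ) :=
    fun w => exists_unit_of_ord_eq_zero fun P => hw w (hwX w) P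
  choose η hη using hη
  have hηlog : ∀ w w' : InfinitePlace K, w' ≠ w →
      Real.log (w' (algebraMap (𝓞 K) K (η w))) < 0 := by
    intro w w' hne
    have h1 := hlog w (hwX w) w' hne
    have h2 : sUnitsVal K S (y ⟨Sum.inr w, hwX w⟩) =
      Additive.ofMul (Units.map (algebraMap (𝓞 K) K).toMonoidHom (η w)) :=
        Additive.toMul.injective (hη w).symm
    rw [h2] at h1
    exact h1
  let j : Additive (𝓞 K)ˣ →+ Additive Kˣ :=
    (Units.map (algebraMap (𝓞 K) K).toMonoidHom).toAdditive
  have hj : Function.Injective j := fun a b h => Additive.toMul.injective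
    (Units.map_injective (FaithfulSMul.algebraMap_injective (𝓞 K) K) (congrArg Additive.toMul h))
  have hval : ∀ f : above K S → ℤ, (∀ P h, f ⟨Sum.inl P, h⟩ = 0) →
      sUnitsVal K S (∑ x, f x • y x) =
        j (∑ w, f ⟨Sum.inr w, hwX w⟩ • Additive.ofMul (η w)) := by
    intro f hf
    rw [sum_above_eq_sum_infinitePlace hwX _ fun P h => by rw [hf, zero_smul], map_sum, map_sum]
    refine Finset.sum_congr rfl fun w _ => ?_
    rw [map_zsmul, map_zsmul]
    exact congrArg _ (Additive.toMul.injective (hη w).symm)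
  refine ⟨φ, ?_, ?_, ?_, ?_⟩
  · rw [injective_iff_map_eq_zero]
    intro f hf
    rw [hφ, Prod.mk_eq_zero] at hf
    have hf0 : ∀ P h, f ⟨Sum.inl P, h⟩ = 0 := by
      intro P h
      have h1 := hordsum f P h
      rw [hf.1, map_zero, map_zero] at h1
      exact (mul_eq_zero.1 h1.symm).resolve_right hm
    have h1 := hval f hf0
    rw [hf.1, map_zero] at h1
    have h2 := hf.2
    rw [sum_above_eq_sum_infinitePlace hwX _ fun P h => by rw [hf0, zero_mul]] at h2
    have h3 := eq_zero_of_sum_zsmul_units_eq_zero η hηlog (fun w => f ⟨Sum.inr w, hwX w⟩)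
      (hj (by rw [map_zero]; exact h1.symm)) (by simpa [d] using h2)
    funext x
    rcases x with ⟨P | w, hx⟩
    · exact hf0 P hx
    · exact congrFun h3 w
  · have := finite_sUnits (K := K) hS
    refine index_ne_zero_of_forall_zsmul_mem _ ?_
    rintro ⟨u, k⟩
    -- the finite places take care of a multiple of `u` up to a unit
    let f₁ : above K S → ℤ := fun x =>
      Sum.elim (fun P => ord K P (sUnitsVal K S u)) (fun _ => 0) x.1
    have h1 : ∀ P : HeightOneSpectrum (𝓞 K),
        ord K P (sUnitsVal K S (m • u - ∑ x, f₁ x • y x)) = 0 := by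
      intro P
      by_cases hPX : Sum.inl P ∈ above K S
      · rw [map_sub, map_sub, hordsum _ P hPX, map_zsmul, map_zsmul, smul_eq_mul, mul_comm]
        exact sub_self _
      · exact ord_sUnitsVal_eq_zero _ hPX
    obtain ⟨v, hv⟩ := exists_unit_of_ord_eq_zero
      (x := (sUnitsVal K S (m • u - ∑ x, f₁ x • y x)).toMul) h1
    obtain ⟨c, hc, a, ha, hak⟩ := exists_zsmul_eq_sum_units η hηlog v (m * k)
    let f₂ : above K S → ℤ := fun x => Sum.elim (fun _ => 0) a x.1
    refine ⟨c * m, mul_ne_zero hc hm, c • f₁ + f₂, ?_⟩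
    have h2 : c • (m • u - ∑ x, f₁ x • y x) = ∑ x, f₂ x • y x := by
      refine sUnitsVal_injective S ?_
      rw [hval f₂ fun _ _ => rfl]
      change _ = j (∑ w, a w • Additive.ofMul (η w))
      rw [← ha, map_zsmul, map_zsmul]
      exact congrArg _ (Additive.toMul.injective hv.symm)
    have hd₁ : ∑ x, f₁ x * d x = 0 := by
      refine Finset.sum_eq_zero ?_
      rintro ⟨P | w, hx⟩ -
      · exact mul_zero _
      · exact zero_mul _
    have hd₂ : ∑ x, f₂ x * d x = ∑ w, a w := by
      rw [sum_above_eq_sum_infinitePlace hwX _ fun P h => zero_mul _]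
      exact Finset.sum_congr rfl fun w _ => mul_one _
    rw [map_add, map_zsmul, hφ, hφ, hd₁, hd₂, ← h2, ← hak]
    refine Prod.ext ?_ ?_
    · change c • ∑ x, f₁ x • y x + c • (m • u - ∑ x, f₁ x • y x) = (c * m) • u
      rw [← zsmul_add, add_sub_cancel, mul_zsmul]
    · simp [mul_assoc]
  · intro f
    rw [hφ, hφ]
    refine Prod.ext ?_ ?_
    · change ∑ x, (f (σ⁻¹ • x) - f x) • y x = sUnitsDiff S σ (∑ x, f x • y x)
      rw [sUnitsDiff_apply, ← hy, ← Finset.sum_sub_distrib]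
      exact Finset.sum_congr rfl fun x _ => sub_smul _ _ _
    · change ∑ x, (f (σ⁻¹ • x) - f x) * d x = 0
      simp_rw [sub_mul]
      rw [Finset.sum_sub_distrib, hdf, sub_self]
  · intro f
    rw [hφ, hφ]
    refine Prod.ext ?_ ?_
    · change ∑ x, (∑ g : Gal(K/F), f (g • x)) • y x = sUnitsNorm F K S (∑ x, f x • y x)
      rw [sUnitsNorm_apply]
      have h1 : ∀ x, (∑ g : Gal(K/F), f (g • x)) • y x = ∑ g : Gal(K/F), f (g • x) • y x :=
        fun x => map_sum (zmultiplesHom _ (y x)) _ _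
      rw [Finset.sum_congr rfl fun x _ => h1 x, Finset.sum_comm,
        Finset.sum_congr rfl fun g _ => (hy g f).symm]
      exact Fintype.sum_equiv (Equiv.inv _) _ _ fun g => by simp
    · change ∑ x, (∑ g : Gal(K/F), f (g • x)) * d x = (Nat.card Gal(K/F) : ℤ) * ∑ x, f x * d x
      simp_rw [Finset.sum_mul]
      rw [Finset.sum_comm]
      simp_rw [hdf]
      simp [Nat.card_eq_fintype_card]

/-! ### The Herbrand quotient of the `S`-units -/

/-- The Herbrand quotient of the `S`-units, cross-multiplied. The factor `Nat.card Gal(K/F)` comes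
from the trivial module `ℤ` in `exists_permutation_sublattice`. -/
theorem prod_card_stabilizer_mul_relIndex {S : Finset (Place F)}
    (hinf : ∀ v : InfinitePlace F, Sum.inr v ∈ S) {σ : Gal(K/F)}
    (hσ : ∀ g, g ∈ Subgroup.zpowers σ) (w : Place F → Place K) (hw : ∀ v ∈ S, LiesAbove (w v) v) :
    (∏ v ∈ S, Nat.card (decompositionGroup F (w v))) *
        (sUnitsDiff (S : Set (Place F)) σ).range.relIndex
          (sUnitsNorm F K (S : Set (Place F))).ker =
      (sUnitsNorm F K (S : Set (Place F))).range.relIndex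
          (sUnitsDiff (S : Set (Place F)) σ).ker * Nat.card Gal(K/F) := by
  have hfin := finite_above (K := K) (S : Set (Place F)) S.finite_toSet
  let _ : Fintype (above K (S : Set (Place F))) := hfin.fintype
  obtain ⟨φ, hφ, hφfin, hT, hN⟩ := exists_permutation_sublattice (K := K) S.finite_toSet hinf σ
  have h1 := relIndex_range_ker_comparison φ hφ hφfin _ _ _ _ hT hN
    (fun b => Prod.ext (sUnitsDiff_sUnitsNorm _ σ b.1) rfl)
    (fun b => Prod.ext (sUnitsNorm_sUnitsDiff _ σ b.1) (mul_zero (Nat.card Gal(K/F) : ℤ)))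
  -- the orbits of the Galois group on the places above `S` are indexed by `S`
  let r : S → above K (S : Set (Place F)) := fun v => ⟨w v, v.1, v.2, hw v v.2⟩
  choose i hiS hi using fun x : above K (S : Set (Place F)) => x.2
  let i' : above K (S : Set (Place F)) → S := fun x => ⟨i x, hiS x⟩
  have hr : ∀ x, ∃ g : Gal(K/F), g • x = r (i' x) := by
    intro x
    obtain ⟨g, hg⟩ := (hi x).exists_smul_eq (hw _ (hiS x))
    exact ⟨g, Subtype.ext hg⟩
  have hig : ∀ (g : Gal(K/F)) x, i' (g • x) = i' x := fun g x =>
    Subtype.ext ((liesAbove_smul_iff.1 (hi (g • x))).unique (hi x))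
  have hir : ∀ v, i' (r v) = v := fun v => Subtype.ext ((hi (r v)).unique (hw v v.2))
  have hstab : ∏ v : S, Nat.card (MulAction.stabilizer Gal(K/F) (r v)) =
      ∏ v ∈ S, Nat.card (decompositionGroup F (w v)) := by
    rw [← Finset.prod_coe_sort S]
    refine Finset.prod_congr rfl fun v _ => ?_
    rw [decompositionGroup_eq_stabilizer]
    refine Nat.card_congr (Equiv.subtypeEquivRight fun g => ?_)
    rw [MulAction.mem_stabilizer_iff, MulAction.mem_stabilizer_iff, Subtype.ext_iff]
    rfl
  rw [relIndex_permNorm_range r i' hσ hr hig hir, hstab,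
    AddSubgroup.relIndex_eq_one.2 (ker_permNorm_le_range_permDiff r i' hσ hr hig), mul_one,
    AddMonoidHom.range_prodMap, AddMonoidHom.range_prodMap, AddMonoidHom.ker_prodMap,
    AddMonoidHom.ker_prodMap, AddSubgroup.relIndex_prod, AddSubgroup.relIndex_prod] at h1
  -- the trivial module `ℤ` contributes the order of the group
  have hn : (Nat.card Gal(K/F) : ℤ) ≠ 0 := Nat.cast_ne_zero.2 Nat.card_pos.ne'
  have h2 : (AddMonoidHom.mulLeft (Nat.card Gal(K/F) : ℤ)).ker = ⊥ :=
    (AddMonoidHom.ker_eq_bot_iff _).2 (mul_right_injective₀ hn)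
  have h3 : (0 : ℤ →+ ℤ).ker = ⊤ := AddMonoidHom.ker_zero
  have h4 : (AddMonoidHom.mulLeft (Nat.card Gal(K/F) : ℤ)).range =
      AddSubgroup.zmultiples (Nat.card Gal(K/F) : ℤ) := by
    ext k
    simp [AddSubgroup.mem_zmultiples_iff, mul_comm]
  rw [h2, h3, h4, AddSubgroup.relIndex_bot_right, mul_one, AddSubgroup.relIndex_top_right,
    Int.index_zmultiples, Int.natAbs_natCast] at h1
  exact h1

end Lattice

end SHilbert

end

theorem mainTheorem1 (F K : Type*) [Field F] [NumberField F] [Field K] [NumberField K]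
    [Algebra F K] [IsGalois F K] [IsCyclic Gal(K/F)]
    (S : Finset (SHilbert.Place F)) (hS : ∀ v : InfinitePlace F, Sum.inr v ∈ S)
    (hur : SHilbert.UnramifiedOutside K (S : Set (SHilbert.Place F)))
    (w : SHilbert.Place F → SHilbert.Place K)
    (hw : ∀ v ∈ S, SHilbert.LiesAbove (w v) v) :
    (∏ v ∈ S, Nat.card (SHilbert.decompositionGroup F (w v))) *
        Nat.card (SHilbert.capitulationMap F K (S : Set (SHilbert.Place F))).ker =
      (SHilbert.normSUnits (K := K) (S : Set (SHilbert.Place F))).range.index *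
        Module.finrank F K := by
  obtain ⟨σ, hσ⟩ := IsCyclic.exists_generator (α := Gal(K/F))
  rw [← SHilbert.relIndex_sUnitsDiff_range _ hur hσ, ← SHilbert.relIndex_sUnitsNorm_range _ hσ,
    ← IsGalois.card_aut_eq_finrank]
  exact SHilbert.prod_card_stabilizer_mul_relIndex hS hσ w hw
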